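/- For a finite simple graph $G=(V,E)$ let $H^k(G)$, $k\ge 0$, be the real simplicial cohomology of its clique complex (the simplicial complex whose simplices are the non-empty vertex sets of complete subgraphs of $G$), let $b_k(G)=\dim_{\mathbb R} H^k(G)$ be its Betti numbers and let $p(G)=\sum_{k\ge 0} b_k(G)\,x^k\in\mathbb Z[x]$ be its Poincaré polynomial. For finite simple graphs $G$ and $H$ let $G\oplus H$ be their disjoint union and let $G\boxtimes H$ be their strong product, i.e. the graph on $V(G)\times V(H)$ in which two distinct vertices $(a,b)$ and $(c,d)$ are adjacent if and only if $a=c$ or $\{a,c\}\in E(G)$, and $b=d$ or $\{b,d\}\in E(H)$. Isomorphism classes of finite simple graphs form a commutative semiring under $\oplus$ and $\boxtimes$, with the empty graph as zero and the one-point graph $K_1$ as one; the strong ring $\mathcal G$ (the ring of signed graphs) is its Grothendieck ring, whose elements are formal differences $A\ominus B$ of graphs, with $A\ominus B=C\ominus D$ if and only if $A\oplus D\oplus K\cong C\oplus B\oplus K$ for some finite graph $K$. Theorem (Künneth formula on the strong ring). For all finite simple graphs $G$ and $H$, $$p(G\oplus H)=p(G)+p(H),\qquad p(G\boxtimes H)=p(G)\,p(H),$$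 and hence the Betti numbers satisfy the Künneth formula $$b_k(G\boxtimes H)=\sum_{i+j=k} b_i(G)\,b_j(H)\qquad (k\ge 0).$$ Moreover $p$ extends uniquely to a ring homomorphism $\mathcal G\to\mathbb Z[x]$ on the strong ring. -/

import Mathlib

open scoped Polynomial

universe u v w

noncomputable section

namespace StrongRing

/-! ### Graph products -/

section Graph

variable {V : Type u} {W : Type v} {X : Type w}

/-- The direct (tensor) product: `(a, b)` and `(c, d)` are adjacent iff `a ~ c` and `b ~ d`. -/
def tensorProd (G : SimpleGraph V) (H : SimpleGraph W) : SimpleGraph (V × W) where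
  Adj x y := G.Adj x.1 y.1 ∧ H.Adj x.2 y.2
  symm.symm _ _ h := ⟨h.1.symm, h.2.symm⟩
  loopless.irrefl _ h := G.loopless.irrefl _ h.1

/-- Sabidussi's strong product: the edge set is the union of the edge sets of the
weak (Cartesian, box) product and of the direct (tensor) product. -/
def strongProd (G : SimpleGraph V) (H : SimpleGraph W) : SimpleGraph (V × W) :=
  G.boxProd H ⊔ tensorProd G H

theorem strongProd_adj (G : SimpleGraph V) (H : SimpleGraph W) (x y : V × W) :
    (strongProd G H).Adj x y ↔
      (G.Adj x.1 y.1 ∧ x.2 = y.2 ∨ H.Adj x.2 y.2 ∧ x.1 = y.1) ∨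
        (G.Adj x.1 y.1 ∧ H.Adj x.2 y.2) :=
  Iff.rfl

/-- Isomorphic factors have isomorphic strong products. -/
def strongProdCongr {V' : Type u} {W' : Type v} {G : SimpleGraph V} {H : SimpleGraph W}
    {G' : SimpleGraph V'} {H' : SimpleGraph W'} (e : G ≃g G') (f : H ≃g H') :
    strongProd G H ≃g strongProd G' H' where
  toEquiv := Equiv.prodCongr e.toEquiv f.toEquiv
  map_rel_iff' {x y} := by
    have he : ∀ a b, G'.Adj (e a) (e b) ↔ G.Adj a b := fun _ _ => e.map_rel_iff'
    have hf : ∀ a b, H'.Adj (f a) (f b) ↔ H.Adj a b := fun _ _ => f.map_rel_iff'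
    simp [strongProd_adj, he, hf]

/-- The strong product is commutative up to isomorphism. -/
def strongProdComm (G : SimpleGraph V) (H : SimpleGraph W) : strongProd G H ≃g strongProd H G where
  toEquiv := Equiv.prodComm V W
  map_rel_iff' {x y} := by
    simp only [strongProd_adj, Equiv.prodComm_apply, Prod.fst_swap, Prod.snd_swap]
    tauto

/-- The strong product is associative up to isomorphism. -/
def strongProdAssoc (G : SimpleGraph V) (H : SimpleGraph W) (K : SimpleGraph X) :
    strongProd (strongProd G H) K ≃g strongProd G (strongProd H K) where
  toEquiv := Equiv.prodAssoc V W X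
  map_rel_iff' {x y} := by
    simp only [strongProd_adj, Equiv.prodAssoc_apply, Prod.ext_iff]
    tauto

/-- The strong product distributes over disjoint unions up to isomorphism. -/
def sumStrongProd (G : SimpleGraph V) (H : SimpleGraph W) (K : SimpleGraph X) :
    strongProd (G.sum H) K ≃g (strongProd G K).sum (strongProd H K) where
  toEquiv := Equiv.sumProdDistrib V W X
  map_rel_iff' {x y} := by
    rcases x with ⟨a | a, x⟩ <;> rcases y with ⟨b | b, y⟩ <;> simp [strongProd_adj]

/-- The one-point graph is a unit for the strong product up to isomorphism. -/
def punitStrongProd (G : SimpleGraph V) :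
    strongProd (⊥ : SimpleGraph PUnit.{w + 1}) G ≃g G where
  toEquiv := Equiv.punitProd V
  map_rel_iff' {x y} := by
    simp [strongProd_adj]

/-- The empty graph is neutral for the disjoint union up to isomorphism. -/
def pemptySum (G : SimpleGraph V) : (⊥ : SimpleGraph PEmpty.{w + 1}).sum G ≃g G where
  toEquiv := Equiv.emptySum PEmpty V
  map_rel_iff' {x y} := by
    rcases x with ⟨⟨⟩⟩ | x
    rcases y with ⟨⟨⟩⟩ | y
    simp

end Graph

/-! ### Simplicial cohomology of the clique complex -/

section Cohomology

variable {V : Type u} (G : SimpleGraph V)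

/-- The `n`-tuples of vertices (repetitions allowed) whose entries span a complete subgraph. -/
def CliqueTuple (n : ℕ) : Type u :=
  {x : Fin n → V // G.IsClique (Set.range x)}

variable {G} in
/-- Rearranging (or repeating, or omitting) the entries of a clique tuple. -/
def CliqueTuple.comp {m n : ℕ} (x : CliqueTuple G n) (f : Fin m → Fin n) : CliqueTuple G m :=
  ⟨x.1 ∘ f, x.2.subset (Set.range_comp_subset_range f x.1)⟩

/-- The real simplicial `k`-cochains of the clique complex of `G`: the alternating functions on the
`(k+1)`-tuples of vertices that span a complete subgraph. (Such a function vanishes on tuples with a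
repeated entry, so after a choice of orientations it is a function on the `k`-simplices.) -/
def Cochain (k : ℕ) : Submodule ℝ (CliqueTuple G (k + 1) → ℝ) where
  carrier := {f | ∀ (σ : Equiv.Perm (Fin (k + 1))) (x : CliqueTuple G (k + 1)),
    f (x.comp σ) = ((Equiv.Perm.sign σ : ℤ) : ℝ) * f x}
  add_mem' hf hg σ x := by
    simp only [Pi.add_apply, hf σ x, hg σ x, mul_add]
  zero_mem' σ x := by simp
  smul_mem' c f hf σ x := by
    simp only [Pi.smul_apply, smul_eq_mul, hf σ x]
    ring

/-- The simplicial coboundary `(df)(x₀, …, xₙ) = ∑ᵢ (-1)ⁱ f(x₀, …, x̂ᵢ, …, xₙ)`. It is defined on all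
functions of tuples, and maps alternating cochains to alternating cochains by
`coboundary_mem_cochain`. -/
def coboundary (n : ℕ) : (CliqueTuple G n → ℝ) →ₗ[ℝ] (CliqueTuple G (n + 1) → ℝ) where
  toFun f x := ∑ i : Fin (n + 1), (-1 : ℝ) ^ (i : ℕ) * f (x.comp i.succAbove)
  map_add' f g := by
    funext x
    simp [mul_add, Finset.sum_add_distrib]
  map_smul' c f := by
    funext x
    simp [Finset.mul_sum, mul_left_comm]

theorem coboundary_apply (n : ℕ) (f : CliqueTuple G n → ℝ) (x : CliqueTuple G (n + 1)) :
    coboundary G n f x = ∑ i : Fin (n + 1), (-1 : ℝ) ^ (i : ℕ) * f (x.comp i.succAbove) :=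
  rfl

theorem coboundary_mem_cochain (k : ℕ) (f : CliqueTuple G (k + 1) → ℝ) (hf : f ∈ Cochain G k) :
    coboundary G (k + 1) f ∈ Cochain G (k + 1) := by
  have key : ∀ (j : Fin (k + 1)) (x : CliqueTuple G (k + 2)),
      coboundary G (k + 1) f (x.comp (Equiv.swap j.castSucc j.succ)) =
        - coboundary G (k + 1) f x := by
    intro j x
    have hne : j.castSucc ≠ j.succ := (Fin.castSucc_lt_succ (i := j)).ne
    simp only [coboundary_apply]
    rw [← Finset.sum_neg_distrib, ← Equiv.sum_comp (Equiv.swap j.castSucc j.succ)]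
    refine Finset.sum_congr rfl fun i _ => ?_
    have hcomp : ∀ (m : Fin (k + 2)) (g : Fin (k + 1) → Fin (k + 2)),
        (⇑(Equiv.swap j.castSucc j.succ) ∘ m.succAbove = g) →
        (x.comp (Equiv.swap j.castSucc j.succ)).comp m.succAbove = x.comp g := by
      rintro m g rfl
      rfl
    rcases eq_or_ne i j.castSucc with rfl | h1
    · rw [Equiv.swap_apply_left, hcomp j.succ j.castSucc.succAbove, Fin.val_succ, Fin.val_castSucc,
        pow_succ]
      · ring
      · funext l
        simp only [Function.comp_apply, Fin.succAbove, Equiv.swap_apply_def, Fin.ext_iff,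
          Fin.lt_def, Fin.val_castSucc, Fin.val_succ]
        split_ifs <;> simp_all [Fin.ext_iff] <;> omega
    rcases eq_or_ne i j.succ with rfl | h2
    · rw [Equiv.swap_apply_right, hcomp j.castSucc j.succ.succAbove, Fin.val_succ, Fin.val_castSucc,
        pow_succ]
      · ring
      · funext l
        simp only [Function.comp_apply, Fin.succAbove, Equiv.swap_apply_def, Fin.ext_iff,
          Fin.lt_def, Fin.val_castSucc, Fin.val_succ]
        split_ifs <;> simp_all [Fin.ext_iff] <;> omega
    · rw [Equiv.swap_apply_of_ne_of_ne h1 h2]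
      obtain ⟨a, ha⟩ := Fin.exists_succAbove_eq h1.symm
      obtain ⟨b, hb⟩ := Fin.exists_succAbove_eq h2.symm
      have hab : a ≠ b := by
        rintro rfl
        exact hne (ha.symm.trans hb)
      rw [hcomp i (i.succAbove ∘ Equiv.swap a b)]
      · have := hf (Equiv.swap a b) (x.comp i.succAbove)
        rw [Equiv.Perm.sign_swap hab] at this
        change f (x.comp (i.succAbove ∘ Equiv.swap a b)) = _ at this
        rw [this]
        simp
      · rw [← ha, ← hb]
        funext l
        exact (Fin.succAbove_right_injective.swap_apply a b l)
  intro σ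
  have hσ : σ ∈ Submonoid.closure
      (Set.range fun i : Fin (k + 1) => Equiv.swap i.castSucc i.succ) := by
    rw [Equiv.Perm.mclosure_swap_castSucc_succ]
    trivial
  induction hσ using Submonoid.closure_induction with
  | mem τ hτ =>
    obtain ⟨j, rfl⟩ := hτ
    intro x
    rw [key j x, Equiv.Perm.sign_swap (Fin.castSucc_lt_succ (i := j)).ne]
    simp
  | one =>
    intro x
    rw [Equiv.Perm.sign_one]
    change coboundary G (k + 1) f x = _
    simp
  | mul τ ρ _ _ hτ hρ =>
    intro x
    have h := hρ (x.comp τ)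
    rw [hτ x] at h
    rw [Equiv.Perm.sign_mul]
    refine Eq.trans h ?_
    push_cast
    ring

theorem coboundary_coboundary (n : ℕ) (f : CliqueTuple G n → ℝ) :
    coboundary G (n + 1) (coboundary G n f) = 0 := by
  funext x
  simp only [coboundary_apply, Finset.mul_sum, Fin.sum_sum_eq_sum_triangle_add]
  refine Finset.sum_eq_zero fun i _ => Finset.sum_eq_zero fun j hj => ?_
  rw [Finset.mem_Ici] at hj
  have h : (x.comp i.castSucc.succAbove).comp j.succAbove =
      (x.comp j.succ.succAbove).comp i.succAbove := by
    apply Subtype.ext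
    funext l
    change x.1 (i.castSucc.succAbove (j.succAbove l)) = x.1 (j.succ.succAbove (i.succAbove l))
    refine congrArg x.1 ?_
    rw [Fin.le_def] at hj
    simp only [Fin.succAbove, Fin.ext_iff, Fin.lt_def, Fin.val_castSucc, Fin.val_succ]
    split_ifs <;> simp_all <;> omega
  rw [h]
  simp [pow_succ]
  ring

/-- The space `Zᵏ` of `k`-cocycles: alternating cochains `f` with `df = 0`. -/
def cocycles (k : ℕ) : Submodule ℝ (CliqueTuple G (k + 1) → ℝ) :=
  Cochain G k ⊓ LinearMap.ker (coboundary G (k + 1))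

/-- The space `Bᵏ` of `k`-coboundaries: the image under `d` of the alternating `(k-1)`-cochains,
which is `0` for `k = 0`. -/
def coboundaries : (k : ℕ) → Submodule ℝ (CliqueTuple G (k + 1) → ℝ)
  | 0 => ⊥
  | k + 1 => (Cochain G k).map (coboundary G (k + 1))

theorem coboundaries_le_cocycles (k : ℕ) : coboundaries G k ≤ cocycles G k := by
  cases k with
  | zero => exact bot_le
  | succ k =>
    rintro _ ⟨f, hf, rfl⟩
    exact ⟨coboundary_mem_cochain G k f hf, coboundary_coboundary G (k + 1) f⟩

/-- The real simplicial cohomology `Hᵏ(G) = Zᵏ / Bᵏ` of the clique complex of `G`. -/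
abbrev Cohomology (k : ℕ) : Type u :=
  cocycles G k ⧸ (coboundaries G k).submoduleOf (cocycles G k)

/-- The Betti number `b_k(G) = dim Hᵏ(G)`. -/
def bettiNumber (k : ℕ) : ℕ := Module.finrank ℝ (Cohomology G k)

theorem bettiNumber_eq_zero [Finite V] {k : ℕ} (hk : Nat.card V ≤ k) : bettiNumber G k = 0 := by
  have h0 : ∀ f : cocycles G k, f = 0 := by
    intro f
    apply Subtype.ext
    funext x
    have hx : ¬ Function.Injective x.1 := by
      intro h
      have := Nat.card_le_card_of_injective x.1 h
      simp at this
      omega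
    simp only [Function.Injective, not_forall] at hx
    obtain ⟨i, j, hij, hne⟩ := hx
    have h1 := f.2.1 (Equiv.swap i j) x
    have h2 : x.comp (Equiv.swap i j) = x := by
      apply Subtype.ext
      funext l
      simp only [CliqueTuple.comp, Function.comp_apply]
      rcases eq_or_ne l i with rfl | hli
      · rw [Equiv.swap_apply_left, hij]
      rcases eq_or_ne l j with rfl | hlj
      · rw [Equiv.swap_apply_right, hij]
      rw [Equiv.swap_apply_of_ne_of_ne hli hlj]
    rw [h2, Equiv.Perm.sign_swap hne] at h1
    simp at h1
    simp
    linarith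
  have : Subsingleton (cocycles G k) := ⟨fun a b => (h0 a).trans (h0 b).symm⟩
  exact Module.finrank_zero_of_subsingleton

/-- The Poincaré polynomial `p(G) = ∑_k b_k(G) x^k` of a finite graph; the Betti numbers
`b_k(G)` with `k ≥ |V|` vanish, as `coeff_poincarePolynomial` records. -/
def poincarePolynomial : ℤ[X] :=
  ∑ k ∈ Finset.range (Nat.card V), Polynomial.monomial k (bettiNumber G k : ℤ)

theorem coeff_poincarePolynomial [Finite V] (k : ℕ) :
    (poincarePolynomial G).coeff k = bettiNumber G k := by
  simp only [poincarePolynomial, Polynomial.finsetSum_coeff, Polynomial.coeff_monomial]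
  rw [Finset.sum_ite_eq' (Finset.range (Nat.card V)) k]
  split_ifs with h
  · rfl
  · rw [bettiNumber_eq_zero G (by simpa using h)]
    rfl

end Cohomology

/-! ### The semiring of finite simple graphs -/

/-- A finite simple graph. -/
structure FinGraph : Type (u + 1) where
  /-- the vertex set -/
  V : Type u
  finite : Finite V
  /-- the adjacency structure -/
  graph : SimpleGraph V

attribute [instance] FinGraph.finite

namespace FinGraph

/-- Two finite graphs are identified when they are isomorphic. -/
instance setoid : Setoid FinGraph.{u} where
  r G H := Nonempty (G.graph ≃g H.graph)
  iseqv := ⟨fun _ => ⟨SimpleGraph.Iso.refl⟩, fun ⟨e⟩ => ⟨e.symm⟩, fun ⟨e⟩ ⟨f⟩ => ⟨e.trans f⟩⟩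

/-- Disjoint union of finite graphs. -/
def add (G H : FinGraph.{u}) : FinGraph.{u} := ⟨G.V ⊕ H.V, inferInstance, G.graph.sum H.graph⟩

/-- Strong product of finite graphs. -/
def mul (G H : FinGraph.{u}) : FinGraph.{u} :=
  ⟨G.V × H.V, inferInstance, strongProd G.graph H.graph⟩

/-- The empty graph. -/
def zero : FinGraph.{u} := ⟨PEmpty, inferInstance, ⊥⟩

/-- The one-point graph `K₁`. -/
def one : FinGraph.{u} := ⟨PUnit, inferInstance, ⊥⟩

end FinGraph

/-- Isomorphism classes of finite simple graphs. -/
def GraphClass : Type (u + 1) := Quotient FinGraph.setoid.{u}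

namespace GraphClass

/-- The isomorphism class of a finite graph. -/
def mk (G : FinGraph.{u}) : GraphClass.{u} := Quotient.mk _ G

theorem mk_eq {G H : FinGraph.{u}} (e : G.graph ≃g H.graph) : mk G = mk H := Quotient.sound ⟨e⟩

/-- Addition is disjoint union. -/
instance : Add GraphClass.{u} where
  add := Quotient.map₂ FinGraph.add (by
    rintro G G' ⟨e⟩ H H' ⟨f⟩
    refine ⟨⟨Equiv.sumCongr e.toEquiv f.toEquiv, ?_⟩⟩
    rintro (a | a) (b | b)
    · exact e.map_rel_iff'
    · exact Iff.rfl
    · exact Iff.rfl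
    · exact f.map_rel_iff')

/-- Multiplication is the strong product. -/
instance : Mul GraphClass.{u} where
  mul := Quotient.map₂ FinGraph.mul (by
    rintro G G' ⟨e⟩ H H' ⟨f⟩
    exact ⟨strongProdCongr e f⟩)

instance : Zero GraphClass.{u} := ⟨mk FinGraph.zero⟩

instance : One GraphClass.{u} := ⟨mk FinGraph.one⟩

theorem mk_add (G H : FinGraph.{u}) : mk G + mk H = mk (G.add H) := rfl

theorem mk_mul (G H : FinGraph.{u}) : mk G * mk H = mk (G.mul H) := rfl

protected theorem ind {P : GraphClass.{u} → Prop} (h : ∀ G, P (mk G)) (a : GraphClass.{u}) : P a :=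
  Quotient.ind h a

protected theorem mul_comm (a b : GraphClass.{u}) : a * b = b * a := by
  induction a using GraphClass.ind with | h G => ?_
  induction b using GraphClass.ind with | h H => ?_
  exact mk_eq (strongProdComm G.graph H.graph)

protected theorem right_distrib (a b c : GraphClass.{u}) : (a + b) * c = a * c + b * c := by
  induction a using GraphClass.ind with | h G => ?_
  induction b using GraphClass.ind with | h H => ?_
  induction c using GraphClass.ind with | h K => ?_
  exact mk_eq (sumStrongProd G.graph H.graph K.graph)

protected theorem one_mul (a : GraphClass.{u}) : 1 * a = a := by
  induction a using GraphClass.ind with | h G => ?_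
  exact mk_eq (punitStrongProd G.graph)

protected theorem zero_mul (a : GraphClass.{u}) : 0 * a = 0 := by
  induction a using GraphClass.ind with | h G => ?_
  refine mk_eq ⟨Equiv.pemptyProd _, ?_⟩
  rintro ⟨⟨⟩, x⟩

protected theorem zero_add (a : GraphClass.{u}) : 0 + a = a := by
  induction a using GraphClass.ind with | h G => ?_
  exact mk_eq (pemptySum G.graph)

protected theorem add_comm (a b : GraphClass.{u}) : a + b = b + a := by
  induction a using GraphClass.ind with | h G => ?_
  induction b using GraphClass.ind with | h H => ?_
  exact mk_eq SimpleGraph.Iso.sumComm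

/-- Isomorphism classes of finite simple graphs form a commutative semiring under disjoint union and
strong product, with the empty graph as zero and `K₁` as one. -/
instance : CommSemiring GraphClass.{u} where
  add_assoc a b c := by
    induction a using GraphClass.ind with | h G => ?_
    induction b using GraphClass.ind with | h H => ?_
    induction c using GraphClass.ind with | h K => ?_
    exact mk_eq SimpleGraph.Iso.sumAssoc
  zero_add := GraphClass.zero_add
  add_zero a := (GraphClass.add_comm a 0).trans (GraphClass.zero_add a)
  add_comm := GraphClass.add_comm
  mul_assoc a b c := by
    induction a using GraphClass.ind with | h G => ?_
    induction b using GraphClass.ind with | h H => ?_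
    induction c using GraphClass.ind with | h K => ?_
    exact mk_eq (strongProdAssoc G.graph H.graph K.graph)
  mul_comm := GraphClass.mul_comm
  one_mul := GraphClass.one_mul
  mul_one a := (GraphClass.mul_comm a 1).trans (GraphClass.one_mul a)
  zero_mul := GraphClass.zero_mul
  mul_zero a := (GraphClass.mul_comm a 0).trans (GraphClass.zero_mul a)
  left_distrib a b c := by
    rw [GraphClass.mul_comm, GraphClass.right_distrib, GraphClass.mul_comm b,
      GraphClass.mul_comm c]
  right_distrib := GraphClass.right_distrib
  nsmul := nsmulRec
  npow := npowRec

end GraphClass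

/-! ### The Grothendieck ring of a commutative semiring -/

/-- The Grothendieck ring of a commutative semiring `R`: its additive group is the Grothendieck group
of `(R, +)`, so its elements are formal differences `a - b`, with `a - b = c - d` iff
`a + d + k = c + b + k` for some `k`. -/
def GrothendieckRing (R : Type u) [CommSemiring R] : Type u := Algebra.GrothendieckAddGroup R

namespace GrothendieckRing

variable {R : Type u} [CommSemiring R]

instance : AddCommGroup (GrothendieckRing R) :=
  inferInstanceAs (AddCommGroup (Algebra.GrothendieckAddGroup R))

/-- The canonical additive map from `R` to its Grothendieck ring. -/
def ofAdd : R →+ GrothendieckRing R := Algebra.GrothendieckAddGroup.of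

theorem exists_eq_sub (x : GrothendieckRing R) : ∃ a b : R, x = ofAdd a - ofAdd b := by
  induction x using AddLocalization.ind with | _ y => ?_
  obtain ⟨a, b, hb⟩ := y
  refine ⟨a, b, ?_⟩
  have h := Algebra.GrothendieckAddGroup.mk_sub_mk a b (0 : (⊤ : AddSubmonoid R)) 0
  refine Eq.trans ?_ h.symm
  simp
  rfl

/-- Lift an additive map out of `R`. -/
def liftAdd {A : Type v} [AddCommGroup A] (f : R →+ A) : GrothendieckRing R →+ A :=
  Algebra.GrothendieckAddGroup.lift f

@[simp]
theorem liftAdd_ofAdd {A : Type v} [AddCommGroup A] (f : R →+ A) (a : R) :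
    liftAdd f (ofAdd a) = f a :=
  DFunLike.congr_fun (Algebra.GrothendieckAddGroup.lift.left_inv f) a

/-- Multiplication, as the biadditive extension of the multiplication of `R`. -/
def mulHom : GrothendieckRing R →+ GrothendieckRing R →+ GrothendieckRing R :=
  liftAdd
    { toFun := fun a => liftAdd (ofAdd.comp (AddMonoidHom.mulLeft a))
      map_zero' := by
        ext x
        obtain ⟨c, d, rfl⟩ := exists_eq_sub x
        simp
      map_add' := fun a b => by
        ext x
        obtain ⟨c, d, rfl⟩ := exists_eq_sub x
        simp [add_mul]
        abel }

instance : Mul (GrothendieckRing R) := ⟨fun x y => mulHom x y⟩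

instance : One (GrothendieckRing R) := ⟨ofAdd 1⟩

theorem mul_def (x y : GrothendieckRing R) : x * y = mulHom x y := rfl

theorem mulHom_ofAdd (a b : R) : mulHom (ofAdd a) (ofAdd b) = ofAdd (a * b) := by
  simp [mulHom]

instance : CommRing (GrothendieckRing R) where
  __ := (inferInstance : AddCommGroup (GrothendieckRing R))
  left_distrib x y z := by simp [mul_def]
  right_distrib x y z := by simp [mul_def]
  zero_mul x := by simp [mul_def]
  mul_zero x := by simp [mul_def]
  mul_assoc x y z := by
    obtain ⟨a, b, rfl⟩ := exists_eq_sub x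
    obtain ⟨c, d, rfl⟩ := exists_eq_sub y
    obtain ⟨e, f, rfl⟩ := exists_eq_sub z
    simp [mul_def, mulHom_ofAdd, mul_assoc]
  one_mul x := by
    obtain ⟨a, b, rfl⟩ := exists_eq_sub x
    change mulHom (ofAdd 1) _ = _
    simp [mulHom_ofAdd]
  mul_one x := by
    obtain ⟨a, b, rfl⟩ := exists_eq_sub x
    change mulHom _ (ofAdd 1) = _
    simp [mulHom_ofAdd]
  mul_comm x y := by
    obtain ⟨a, b, rfl⟩ := exists_eq_sub x
    obtain ⟨c, d, rfl⟩ := exists_eq_sub y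
    simp [mul_def, mulHom_ofAdd, mul_comm]
    abel

/-- The canonical semiring homomorphism from `R` to its Grothendieck ring. -/
def of : R →+* GrothendieckRing R where
  __ := (ofAdd : R →+ GrothendieckRing R)
  map_one' := rfl
  map_mul' a b := (mulHom_ofAdd a b).symm

end GrothendieckRing

/-- The strong ring of signed finite simple graphs: the Grothendieck ring of the semiring of finite
simple graphs (up to isomorphism) under disjoint union and strong product. -/
abbrev SignedGraph : Type (u + 1) := GrothendieckRing GraphClass.{u}

/-- The element of the strong ring represented by a finite graph. -/
def SignedGraph.ofGraph (G : FinGraph.{u}) : SignedGraph.{u} :=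
  GrothendieckRing.of (GraphClass.mk G)

end StrongRing

end

/-!
The real cochains of the clique complex are modelled as functions on finite cliques, oriented by
an injective rank function of the vertices (`bettiNumber_eq_cohDim`). More generally, every
order-convex family `S` of finite sets carries a complex of relative cochains, the functions that
live on `S`; `cohDim` is the dimension of its cohomology.

The Künneth formula rests on a comparison of the strong product with the join. Consider finite
sets that consist of pairs from `V × W`, of vertices of `G` and of vertices of `H`, such that all
components in `V` span a complete subgraph of `G` and all components in `W` one of `H`. Those
which consist of pairs only are the cliques of `G ⊠ H`, because a set of pairs is a clique of the
strong product if and only if both its projections are cliques. Those without pairs that meet both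
`V` and `W` are the joins of a simplex of `G` and a simplex of `H`, so that their cochains form
the tensor product of the cochain complexes of `G` and `H`. Three larger families are acyclic: the
sets with a pair `(a, b)` that miss `W` are coned off by the vertex `a`, the sets with a pair `(a,
b)` and a vertex of `V` by the vertex `b`, and the sets with vertices `a` of `V` and `b` of `W` by
the pair `(a, b)` (`acyclic_pairNoSnd`, `acyclic_pairFst`, `acyclic_fstSnd`). An acyclic family
which is split into two parts gives an isomorphism, with a shift of degrees, between the
cohomologies of the parts (`cohDim_eq_cohDim_succ`). The three splittings together identify the
cohomology of the strong product with that of the join (`cohDim_strongProd_eq_join`).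

The algebraic Künneth formula (`cohDim_tensorDiff`) comes from a retraction of each complex onto
its cohomology: retractions of two complexes have a tensor product, the dimensions of cohomology
are traces of the projections, and the trace of a tensor product is the product of the traces.

Since the Poincaré polynomial is thus additive and multiplicative and equals `1` for a point, it
is a homomorphism of semirings on isomorphism classes of graphs, and extends to the Grothendieck
ring, which is generated by these classes as an additive group.
-/

noncomputable section

namespace StrongRing

/-! ### Cohomology of based cochain complexes -/

/-- A linear map that carries cocycles to cocycles, reflects coboundaries, and hits every cocycle up
to a coboundary identifies the dimensions of the cohomology spaces. -/
theorem finrank_quotient_eq_of_map {M : Type u} {M' : Type v} [AddCommGroup M] [Module ℝ M]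
    [AddCommGroup M'] [Module ℝ M'] {Z B : Submodule ℝ M} {Z' B' : Submodule ℝ M'}
    (φ : M →ₗ[ℝ] M') (hZ : ∀ z ∈ Z, φ z ∈ Z')
    (hB : ∀ z ∈ Z, φ z ∈ B' ↔ z ∈ B) (hsurj : ∀ z' ∈ Z', ∃ z ∈ Z, z' - φ z ∈ B') :
    Module.finrank ℝ (Z ⧸ B.submoduleOf Z) = Module.finrank ℝ (Z' ⧸ B'.submoduleOf Z') := by
  let ψ : Z →ₗ[ℝ] Z' ⧸ B'.submoduleOf Z' := (B'.submoduleOf Z').mkQ ∘ₗ φ.restrict hZ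
  have hker : LinearMap.ker ψ = B.submoduleOf Z := by
    ext z
    rw [LinearMap.mem_ker, LinearMap.comp_apply, Submodule.mkQ_apply,
      Submodule.Quotient.mk_eq_zero]
    exact hB z.1 z.2
  have hψ : Function.Surjective ψ := by
    intro q
    obtain ⟨z', rfl⟩ := (B'.submoduleOf Z').mkQ_surjective q
    obtain ⟨z, hz, h⟩ := hsurj z'.1 z'.2
    refine ⟨⟨z, hz⟩, ?_⟩
    refine ((Submodule.Quotient.eq _).2 ?_).symm
    exact h
  rw [← hker]
  exact (ψ.quotKerEquivOfSurjective hψ).finrank_eq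

section Based

variable {I : Type u} {J : Type v}

/-- The functions on the set of cells `I` that live on cells of `S` of degree `n`. -/
def cochainsOn (deg : I → ℕ) (S : Set I) (n : ℕ) : Submodule ℝ (I → ℝ) where
  carrier := {f | ∀ i, f i ≠ 0 → i ∈ S ∧ deg i = n}
  add_mem' {f g} hf hg i hi := by
    by_cases h : f i = 0
    · exact hg i fun h' => hi (by simp [h, h'])
    · exact hf i h
  zero_mem' i hi := absurd rfl hi
  smul_mem' c f hf i hi := hf i fun h => hi (by simp [h])

theorem mem_cochainsOn {deg : I → ℕ} {S : Set I} {n : ℕ} {f : I → ℝ} :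
    f ∈ cochainsOn deg S n ↔ ∀ i, f i ≠ 0 → i ∈ S ∧ deg i = n :=
  Iff.rfl

theorem cochainsOn_mono {deg : I → ℕ} {S T : Set I} (h : S ⊆ T) (n : ℕ) :
    cochainsOn deg S n ≤ cochainsOn deg T n :=
  fun _ hf i hi => ⟨h (hf i hi).1, (hf i hi).2⟩

/-- Restriction of functions to `S`, followed by extension by zero. -/
def cut (S : Set I) : (I → ℝ) →ₗ[ℝ] (I → ℝ) where
  toFun f := S.indicator f
  map_add' f g := Set.indicator_add' S f g
  map_smul' c f := Set.indicator_const_smul S c f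

theorem cut_apply_of_mem {S : Set I} {i : I} (h : i ∈ S) (f : I → ℝ) : cut S f i = f i :=
  Set.indicator_of_mem h f

theorem cut_apply_of_notMem {S : Set I} {i : I} (h : i ∉ S) (f : I → ℝ) : cut S f i = 0 :=
  Set.indicator_of_notMem h f

/-- The differential induced by `d` on the functions that live on `S`. -/
def relDiff (d : (I → ℝ) →ₗ[ℝ] (I → ℝ)) (S : Set I) : (I → ℝ) →ₗ[ℝ] (I → ℝ) := cut S ∘ₗ d

/-- The `n`-cocycles of the complex of functions that live on `S`. -/
def cocyclesOn (d : (I → ℝ) →ₗ[ℝ] (I → ℝ)) (deg : I → ℕ) (S : Set I) (n : ℕ) :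
    Submodule ℝ (I → ℝ) :=
  cochainsOn deg S n ⊓ LinearMap.ker (relDiff d S)

/-- The `n`-coboundaries of the complex of functions that live on `S`. The primitives live on the
cells `i` with `deg i + 1 = n`, so that there are none for `n = 0`. -/
def coboundariesOn (d : (I → ℝ) →ₗ[ℝ] (I → ℝ)) (deg : I → ℕ) (S : Set I) (n : ℕ) :
    Submodule ℝ (I → ℝ) :=
  (cochainsOn (fun i => deg i + 1) S n).map (relDiff d S)

/-- The dimension of the `n`-th cohomology of the complex of functions that live on `S`. -/
def cohDim (d : (I → ℝ) →ₗ[ℝ] (I → ℝ)) (deg : I → ℕ) (S : Set I) (n : ℕ) : ℕ :=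
  Module.finrank ℝ
    (cocyclesOn d deg S n ⧸ (coboundariesOn d deg S n).submoduleOf (cocyclesOn d deg S n))

/-- `d` raises the degree by one. -/
def RaisesDegree (d : (I → ℝ) →ₗ[ℝ] (I → ℝ)) (deg : I → ℕ) : Prop :=
  ∀ f i, d f i ≠ 0 → ∃ j, f j ≠ 0 ∧ deg i = deg j + 1

/-- The differential induced by `d` on the functions that live on `S` squares to zero. -/
def IsComplexOn (d : (I → ℝ) →ₗ[ℝ] (I → ℝ)) (S : Set I) : Prop :=
  ∀ f : I → ℝ, (∀ i, f i ≠ 0 → i ∈ S) → relDiff d S (relDiff d S f) = 0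

variable {d : (I → ℝ) →ₗ[ℝ] (I → ℝ)} {deg : I → ℕ} {S : Set I} {n : ℕ}

theorem relDiff_apply_of_mem {i : I} (h : i ∈ S) (f : I → ℝ) : relDiff d S f i = d f i :=
  cut_apply_of_mem h _

theorem relDiff_apply_of_notMem {i : I} (h : i ∉ S) (f : I → ℝ) : relDiff d S f i = 0 :=
  cut_apply_of_notMem h _

theorem relDiff_ne_zero (hd : RaisesDegree d deg) {f : I → ℝ} {i : I} (h : relDiff d S f i ≠ 0) :
    i ∈ S ∧ ∃ j, f j ≠ 0 ∧ deg i = deg j + 1 := by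
  by_cases hi : i ∈ S
  · rw [relDiff_apply_of_mem hi] at h
    exact ⟨hi, hd f i h⟩
  · exact absurd (relDiff_apply_of_notMem hi f) h

theorem mem_cocyclesOn {f : I → ℝ} :
    f ∈ cocyclesOn d deg S n ↔ f ∈ cochainsOn deg S n ∧ ∀ i ∈ S, d f i = 0 := by
  refine and_congr_right fun _ => ?_
  rw [SetLike.mem_coe, LinearMap.mem_ker]
  constructor
  · intro h i hi
    rw [← relDiff_apply_of_mem hi, h, Pi.zero_apply]
  · intro h
    funext i
    by_cases hi : i ∈ S
    · rw [relDiff_apply_of_mem hi, h i hi, Pi.zero_apply]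
    · rw [relDiff_apply_of_notMem hi, Pi.zero_apply]

theorem relDiff_mem_cochainsOn (hd : RaisesDegree d deg) {T : Set I} {f : I → ℝ}
    (hf : f ∈ cochainsOn (fun i => deg i + 1) T n) : relDiff d S f ∈ cochainsOn deg S n := by
  intro i hi
  obtain ⟨hS, j, hj, hij⟩ := relDiff_ne_zero hd hi
  exact ⟨hS, hij.trans (hf j hj).2⟩

theorem mem_cochainsOn_succ {f : I → ℝ} :
    f ∈ cochainsOn (fun i => deg i + 1) S (n + 1) ↔ f ∈ cochainsOn deg S n := by
  simp [mem_cochainsOn]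

theorem coboundariesOn_le_cocyclesOn (hd : RaisesDegree d deg) (hS : IsComplexOn d S) :
    coboundariesOn d deg S n ≤ cocyclesOn d deg S n := by
  rintro _ ⟨g, hg, rfl⟩
  exact ⟨relDiff_mem_cochainsOn hd hg, hS g fun i hi => (hg i hi).1⟩

theorem cut_mem_cochainsOn {T : Set I} {f : I → ℝ} (hf : f ∈ cochainsOn deg T n) :
    cut S f ∈ cochainsOn deg S n := by
  intro i hi
  by_cases h : i ∈ S
  · rw [cut_apply_of_mem h] at hi
    exact ⟨h, (hf i hi).2⟩
  · exact absurd (cut_apply_of_notMem h f) hi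

/-- The connecting isomorphism: if the cells of `S ∪ T`, where `d` does not lead back from `T` to
`S`, carry an acyclic complex, then the cohomology of the quotient complex on `S` is that of the
subcomplex on `T`, with a shift of degrees. -/
theorem cohDim_eq_cohDim_succ {T : Set I} (hd : RaisesDegree d deg) (hST : Disjoint S T)
    (hup : ∀ f : I → ℝ, (∀ i, f i ≠ 0 → i ∈ T) → ∀ i ∈ S, d f i = 0)
    (hc : IsComplexOn d (S ∪ T))
    (hac : ∀ n, cocyclesOn d deg (S ∪ T) n ≤ coboundariesOn d deg (S ∪ T) n) (n : ℕ) :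
    cohDim d deg S n = cohDim d deg T (n + 1) := by
  have hsplit : ∀ f, relDiff d (S ∪ T) f = relDiff d S f + relDiff d T f := by
    intro f
    exact Set.indicator_union_of_disjoint hST _
  have hzero : ∀ f : I → ℝ, (∀ i, f i ≠ 0 → i ∈ T) → relDiff d S f = 0 := by
    intro f hf
    funext i
    by_cases hi : i ∈ S
    · rw [relDiff_apply_of_mem hi, hup f hf i hi, Pi.zero_apply]
    · rw [relDiff_apply_of_notMem hi, Pi.zero_apply]
  have hTsupp : ∀ f i, relDiff d T f i ≠ 0 → i ∈ T := by
    intro f i hi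
    by_contra h
    exact hi (relDiff_apply_of_notMem h f)
  have hcutadd : ∀ f : I → ℝ, (∀ i, f i ≠ 0 → i ∈ S ∪ T) → f = cut S f + cut T f := by
    intro f hf
    refine Eq.trans ?_ (Set.indicator_union_of_disjoint hST f)
    exact (Set.indicator_eq_self.2 fun i hi => hf i hi).symm
  have hcutT : ∀ (f : I → ℝ) i, cut T f i ≠ 0 → i ∈ T := by
    intro f i hi
    by_contra h
    exact hi (cut_apply_of_notMem h f)
  refine finrank_quotient_eq_of_map (relDiff d T) ?_ ?_ ?_
  · rintro z ⟨hz, hz0⟩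
    refine ⟨relDiff_mem_cochainsOn hd (mem_cochainsOn_succ.2 hz), ?_⟩
    have h := hc z fun i hi => Or.inl (hz i hi).1
    rw [SetLike.mem_coe, LinearMap.mem_ker] at hz0 ⊢
    rw [hsplit z, hz0, zero_add, hsplit, hzero _ (hTsupp z), zero_add] at h
    exact h
  · rintro z ⟨hz, hz0⟩
    rw [SetLike.mem_coe, LinearMap.mem_ker] at hz0
    constructor
    · rintro ⟨g, hg, hgz⟩
      rw [SetLike.mem_coe, mem_cochainsOn_succ] at hg
      have h : z - g ∈ cocyclesOn d deg (S ∪ T) n := by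
        refine ⟨sub_mem (cochainsOn_mono Set.subset_union_left n hz)
          (cochainsOn_mono Set.subset_union_right n hg), ?_⟩
        rw [SetLike.mem_coe, LinearMap.mem_ker, map_sub, hsplit, hsplit, hz0,
          hzero g fun i hi => (hg i hi).1, hgz]
        simp
      obtain ⟨k, hk, hkz⟩ := hac n h
      refine ⟨cut S k, cut_mem_cochainsOn hk, ?_⟩
      have hk' := hcutadd k fun i hi => (hk i hi).1
      have h1 : relDiff d S k = relDiff d S (cut S k) := by
        conv_lhs => rw [hk', map_add, hzero _ (hcutT k), add_zero]
      rw [← h1]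
      funext i
      by_cases hi : i ∈ S
      · have h2 := congrFun hkz i
        have hgi : g i = 0 := by
          by_contra hgi
          exact Set.disjoint_left.1 hST hi (hg i hgi).1
        rw [relDiff_apply_of_mem (S := S ∪ T) (Or.inl hi), Pi.sub_apply, hgi, sub_zero] at h2
        rw [relDiff_apply_of_mem hi, h2]
      · rw [relDiff_apply_of_notMem hi]
        by_contra hzi
        exact hi (hz i (Ne.symm hzi)).1
    · rintro ⟨g, hg, rfl⟩
      have h := hc g fun i hi => Or.inl (hg i hi).1
      rw [hsplit g, map_add, hsplit, hz0, zero_add, hsplit, hzero _ (hTsupp g), zero_add] at h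
      refine ⟨-relDiff d T g, mem_cochainsOn_succ.2 ?_, ?_⟩
      · exact neg_mem (relDiff_mem_cochainsOn hd hg)
      · rw [map_neg, eq_comm, ← sub_eq_zero, sub_neg_eq_add, h]
  · rintro z' ⟨hz', hz0⟩
    rw [SetLike.mem_coe, LinearMap.mem_ker] at hz0
    have h : z' ∈ cocyclesOn d deg (S ∪ T) (n + 1) := by
      refine ⟨cochainsOn_mono Set.subset_union_right _ hz', ?_⟩
      rw [SetLike.mem_coe, LinearMap.mem_ker, hsplit, hz0,
        hzero z' fun i hi => (hz' i hi).1, add_zero]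
    obtain ⟨g, hg, rfl⟩ := hac _ h
    rw [SetLike.mem_coe, mem_cochainsOn_succ] at hg
    have hg' := hcutadd g fun i hi => (hg i hi).1
    have h1 : relDiff d S g = relDiff d S (cut S g) := by
      conv_lhs => rw [hg', map_add, hzero _ (hcutT g), add_zero]
    have h2 : relDiff d S g = 0 := by
      funext i
      by_cases hi : i ∈ S
      · by_contra hne
        rw [relDiff_apply_of_mem hi, Pi.zero_apply,
          ← relDiff_apply_of_mem (S := S ∪ T) (Or.inl hi)] at hne
        exact Set.disjoint_left.1 hST hi (hz' i hne).1
      · rw [relDiff_apply_of_notMem hi, Pi.zero_apply]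
    refine ⟨cut S g, ⟨cut_mem_cochainsOn hg, ?_⟩, cut T g,
      mem_cochainsOn_succ.2 (cut_mem_cochainsOn hg), ?_⟩
    · rw [SetLike.mem_coe, LinearMap.mem_ker, ← h1, h2]
    · rw [hsplit, h2, zero_add]
      conv_rhs => rw [hg', map_add, add_sub_right_comm, ← hg', sub_self, zero_add]

/-- Cohomology only depends on the cells up to relabelling. -/
theorem cohDim_image {dJ : (J → ℝ) →ₗ[ℝ] (J → ℝ)} {degJ : J → ℕ} {T : Set J} {e : I → J}
    (he : Function.Injective e) (hT : T = e '' S) (hdeg : ∀ i ∈ S, degJ (e i) = deg i)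
    (hcomm : ∀ f : J → ℝ, (∀ j, f j ≠ 0 → j ∈ T) → ∀ i ∈ S, dJ f (e i) = d (f ∘ e) i) (n : ℕ) :
    cohDim dJ degJ T n = cohDim d deg S n := by
  subst hT
  have hext : ∀ g : I → ℝ, Function.extend e g (0 : J → ℝ) ∘ e = g := fun g =>
    Function.extend_comp he g 0
  have hpull : ∀ (degI' : I → ℕ) (degJ' : J → ℕ), (∀ i ∈ S, degJ' (e i) = degI' i) → ∀ (m : ℕ),
      ∀ f ∈ cochainsOn degJ' (e '' S) m, f ∘ e ∈ cochainsOn degI' S m := by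
    intro degI' degJ' h m f hf i hi
    obtain ⟨⟨i', hi', hii'⟩, hm⟩ := hf (e i) hi
    obtain rfl := he hii'
    exact ⟨hi', (h _ hi').symm.trans hm⟩
  have hpush : ∀ (degI' : I → ℕ) (degJ' : J → ℕ), (∀ i ∈ S, degJ' (e i) = degI' i) → ∀ (m : ℕ),
      ∀ g ∈ cochainsOn degI' S m, Function.extend e g 0 ∈ cochainsOn degJ' (e '' S) m := by
    intro degI' degJ' h m g hg j hj
    by_cases hje : ∃ i, e i = j
    · obtain ⟨i, rfl⟩ := hje
      rw [he.extend_apply] at hj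
      exact ⟨⟨i, (hg i hj).1, rfl⟩, (h i (hg i hj).1).trans (hg i hj).2⟩
    · exact absurd (Function.extend_apply' _ _ _ hje) hj
  have hdeg' : ∀ i ∈ S, degJ (e i) + 1 = deg i + 1 := fun i hi => congrArg (· + 1) (hdeg i hi)
  have hrel : ∀ f : J → ℝ, (∀ j, f j ≠ 0 → j ∈ e '' S) →
      relDiff dJ (e '' S) f ∘ e = relDiff d S (f ∘ e) := by
    intro f hf
    funext i
    by_cases hi : i ∈ S
    · rw [Function.comp_apply, relDiff_apply_of_mem (Set.mem_image_of_mem e hi),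
        relDiff_apply_of_mem hi, hcomm f hf i hi]
    · rw [Function.comp_apply, relDiff_apply_of_notMem (by rwa [he.mem_set_image]),
        relDiff_apply_of_notMem hi]
  have hinj : ∀ f f' : J → ℝ, (∀ j, f j ≠ 0 → j ∈ e '' S) → (∀ j, f' j ≠ 0 → j ∈ e '' S) →
      f ∘ e = f' ∘ e → f = f' := by
    intro f f' hf hf' h
    funext j
    by_cases hj : j ∈ e '' S
    · obtain ⟨i, _, rfl⟩ := hj
      exact congrFun h i
    · rw [not_imp_comm.1 (hf j) hj, not_imp_comm.1 (hf' j) hj]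
  have hsupp : ∀ f j, relDiff dJ (e '' S) f j ≠ 0 → j ∈ e '' S := by
    intro f j hj
    by_contra h
    exact hj (relDiff_apply_of_notMem h f)
  have hZ : ∀ z ∈ cocyclesOn dJ degJ (e '' S) n, z ∘ e ∈ cocyclesOn d deg S n := by
    rintro z ⟨hz, hz0⟩
    refine ⟨hpull _ _ hdeg _ z hz, ?_⟩
    rw [SetLike.mem_coe, LinearMap.mem_ker] at hz0 ⊢
    rw [← hrel z fun j hj => (hz j hj).1, hz0]
    rfl
  refine finrank_quotient_eq_of_map (LinearMap.funLeft ℝ ℝ e) hZ ?_ ?_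
  · rintro z ⟨hz, _⟩
    constructor
    · rintro ⟨g, hg, hgz⟩
      have hg' := hpush (fun i => deg i + 1) (fun j => degJ j + 1) hdeg' _ g hg
      refine ⟨_, hg', hinj _ _ (hsupp _) (fun j hj => (hz j hj).1) ?_⟩
      rw [hrel _ fun j hj => (hg' j hj).1, hext, hgz]
      rfl
    · rintro ⟨g, hg, rfl⟩
      exact ⟨g ∘ e,
        hpull (fun i => deg i + 1) (fun j => degJ j + 1) hdeg' _ g hg,
        (hrel g fun j hj => (hg j hj).1).symm⟩
  · rintro z' ⟨hz', hz0⟩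
    have hz := hpush _ _ hdeg _ z' hz'
    refine ⟨_, ⟨hz, ?_⟩, ?_⟩
    · rw [SetLike.mem_coe, LinearMap.mem_ker] at hz0 ⊢
      refine hinj _ _ (hsupp _) (fun j hj => absurd rfl hj) ?_
      rw [hrel _ fun j hj => (hz j hj).1, hext, hz0]
      rfl
    · change z' - Function.extend e z' 0 ∘ e ∈ _
      rw [hext, sub_self]
      exact zero_mem _

theorem cohDim_add_finrank_coboundariesOn [Finite I] (hd : RaisesDegree d deg)
    (hS : IsComplexOn d S) :
    cohDim d deg S n + Module.finrank ℝ (coboundariesOn d deg S n) =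
      Module.finrank ℝ (cocyclesOn d deg S n) := by
  rw [cohDim, ← Submodule.finrank_quotient_add_finrank
    ((coboundariesOn d deg S n).submoduleOf (cocyclesOn d deg S n))]
  congr 1
  exact (Submodule.submoduleOfEquivOfLe (coboundariesOn_le_cocyclesOn hd hS)).finrank_eq.symm

/-- Cohomology is additive over sets of cells between which the differential does not lead. -/
theorem cohDim_union [Finite I] {T : Set I} (hd : RaisesDegree d deg) (hST : Disjoint S T)
    (hTS : ∀ f : I → ℝ, (∀ i, f i ≠ 0 → i ∈ T) → ∀ i ∈ S, d f i = 0)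
    (hST' : ∀ f : I → ℝ, (∀ i, f i ≠ 0 → i ∈ S) → ∀ i ∈ T, d f i = 0)
    (hS : IsComplexOn d S) (hT : IsComplexOn d T) (hc : IsComplexOn d (S ∪ T)) (n : ℕ) :
    cohDim d deg (S ∪ T) n = cohDim d deg S n + cohDim d deg T n := by
  have hsplit : ∀ f, relDiff d (S ∪ T) f = relDiff d S f + relDiff d T f := fun f =>
    Set.indicator_union_of_disjoint hST _
  have hzero : ∀ (A B : Set I), (∀ f : I → ℝ, (∀ i, f i ≠ 0 → i ∈ A) → ∀ i ∈ B, d f i = 0) →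
      ∀ f : I → ℝ, (∀ i, f i ≠ 0 → i ∈ A) → relDiff d B f = 0 := by
    intro A B h f hf
    funext i
    by_cases hi : i ∈ B
    · rw [relDiff_apply_of_mem hi, h f hf i hi, Pi.zero_apply]
    · rw [relDiff_apply_of_notMem hi, Pi.zero_apply]
  have hcut : ∀ (A : Set I) (f : I → ℝ) i, cut A f i ≠ 0 → i ∈ A := by
    intro A f i hi
    by_contra h
    exact hi (cut_apply_of_notMem h f)
  have hcutadd : ∀ f : I → ℝ, (∀ i, f i ≠ 0 → i ∈ S ∪ T) → f = cut S f + cut T f := by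
    intro f hf
    refine Eq.trans ?_ (Set.indicator_union_of_disjoint hST f)
    exact (Set.indicator_eq_self.2 fun i hi => hf i hi).symm
  have hcS : ∀ f : I → ℝ, (∀ i, f i ≠ 0 → i ∈ S ∪ T) → relDiff d S (cut S f) = relDiff d S f := by
    intro f hf
    conv_rhs => rw [hcutadd f hf, map_add, hzero T S hTS _ (hcut T f), add_zero]
  have hcT : ∀ f : I → ℝ, (∀ i, f i ≠ 0 → i ∈ S ∪ T) → relDiff d T (cut T f) = relDiff d T f := by
    intro f hf
    conv_rhs => rw [hcutadd f hf, map_add, hzero S T hST' _ (hcut S f), zero_add]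
  have hdisj : ∀ {f g : I → ℝ}, f + g = 0 → (∀ i, f i ≠ 0 → i ∈ S) → (∀ i, g i ≠ 0 → i ∈ T) →
      f = 0 := by
    intro f g h hf hg
    funext i
    by_contra hi
    have hg0 : g i = 0 := by
      by_contra hgi
      exact Set.disjoint_left.1 hST (hf i hi) (hg i hgi)
    have := congrFun h i
    rw [Pi.add_apply, hg0, add_zero] at this
    exact hi this
  have hsupp : ∀ (A : Set I) f i, relDiff d A f i ≠ 0 → i ∈ A := by
    intro A f i hi
    by_contra h
    exact hi (relDiff_apply_of_notMem h f)
  have hZ : cocyclesOn d deg (S ∪ T) n = cocyclesOn d deg S n ⊔ cocyclesOn d deg T n := by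
    apply le_antisymm
    · rintro f ⟨hf, hf0⟩
      rw [SetLike.mem_coe, LinearMap.mem_ker, hsplit] at hf0
      have hf' : ∀ i, f i ≠ 0 → i ∈ S ∪ T := fun i hi => (hf i hi).1
      have h1 := hdisj hf0 (hsupp S f) (hsupp T f)
      rw [h1, zero_add] at hf0
      rw [hcutadd f hf']
      refine Submodule.add_mem_sup ⟨cut_mem_cochainsOn hf, ?_⟩ ⟨cut_mem_cochainsOn hf, ?_⟩
      · rw [SetLike.mem_coe, LinearMap.mem_ker, hcS f hf', h1]
      · rw [SetLike.mem_coe, LinearMap.mem_ker, hcT f hf', hf0]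
    · refine sup_le ?_ ?_
      · rintro f ⟨hf, hf0⟩
        rw [SetLike.mem_coe, LinearMap.mem_ker] at hf0
        refine ⟨cochainsOn_mono Set.subset_union_left n hf, ?_⟩
        rw [SetLike.mem_coe, LinearMap.mem_ker, hsplit, hf0, zero_add,
          hzero S T hST' f fun i hi => (hf i hi).1]
      · rintro f ⟨hf, hf0⟩
        rw [SetLike.mem_coe, LinearMap.mem_ker] at hf0
        refine ⟨cochainsOn_mono Set.subset_union_right n hf, ?_⟩
        rw [SetLike.mem_coe, LinearMap.mem_ker, hsplit, hf0, add_zero,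
          hzero T S hTS f fun i hi => (hf i hi).1]
  have hB : coboundariesOn d deg (S ∪ T) n =
      coboundariesOn d deg S n ⊔ coboundariesOn d deg T n := by
    apply le_antisymm
    · rintro _ ⟨g, hg, rfl⟩
      have hg' : ∀ i, g i ≠ 0 → i ∈ S ∪ T := fun i hi => (hg i hi).1
      rw [hsplit, ← hcS g hg', ← hcT g hg']
      exact Submodule.add_mem_sup ⟨_, cut_mem_cochainsOn hg, rfl⟩ ⟨_, cut_mem_cochainsOn hg, rfl⟩
    · refine sup_le ?_ ?_
      · rintro _ ⟨g, hg, rfl⟩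
        refine ⟨g, cochainsOn_mono Set.subset_union_left n hg, ?_⟩
        rw [hsplit, hzero S T hST' g fun i hi => (hg i hi).1, add_zero]
      · rintro _ ⟨g, hg, rfl⟩
        refine ⟨g, cochainsOn_mono Set.subset_union_right n hg, ?_⟩
        rw [hsplit, hzero T S hTS g fun i hi => (hg i hi).1, zero_add]
  have hinf : ∀ A B : Submodule ℝ (I → ℝ), A ≤ cochainsOn deg S n → B ≤ cochainsOn deg T n →
      Module.finrank ℝ (A ⊔ B : Submodule ℝ (I → ℝ)) = Module.finrank ℝ A + Module.finrank ℝ B := by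
    intro A B hA hB
    have : A ⊓ B = ⊥ := by
      rw [eq_bot_iff]
      rintro f ⟨hfA, hfB⟩
      refine (Submodule.mem_bot ℝ).2 (hdisj (add_neg_cancel f) (fun i hi => (hA hfA i hi).1) ?_)
      exact fun i hi => (hB (neg_mem hfB) i hi).1
    rw [← Submodule.finrank_sup_add_finrank_inf_eq, this, finrank_bot, add_zero]
  have hle : ∀ A, IsComplexOn d A → coboundariesOn d deg A n ≤ cochainsOn deg A n := fun A hA =>
    (coboundariesOn_le_cocyclesOn hd hA).trans inf_le_left
  have e1 := cohDim_add_finrank_coboundariesOn (n := n) hd hc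
  have e2 := cohDim_add_finrank_coboundariesOn (n := n) hd hS
  have e3 := cohDim_add_finrank_coboundariesOn (n := n) hd hT
  rw [hZ, hB, hinf (cocyclesOn d deg S n) (cocyclesOn d deg T n) inf_le_left inf_le_left,
    hinf _ _ (hle S hS) (hle T hT)] at e1
  omega

end Based

/-! ### The algebraic Künneth formula -/

section Kuenneth

open Matrix
open scoped Kronecker

variable {I : Type u} {J : Type v} [Fintype I] [Fintype J]

theorem exists_ne_zero_of_mul_apply_ne_zero {a b : Matrix I I ℝ} {i j : I}
    (h : (a * b) i j ≠ 0) : ∃ k, a i k ≠ 0 ∧ b k j ≠ 0 := by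
  rw [mul_apply] at h
  obtain ⟨k, -, hk⟩ := Finset.exists_ne_zero_of_sum_ne_zero h
  exact ⟨k, left_ne_zero_of_mul hk, right_ne_zero_of_mul hk⟩

theorem exists_ne_zero_of_mulVec_apply_ne_zero {a : Matrix I I ℝ} {f : I → ℝ} {i : I}
    (h : (a *ᵥ f) i ≠ 0) : ∃ k, a i k ≠ 0 ∧ f k ≠ 0 := by
  obtain ⟨k, -, hk⟩ := Finset.exists_ne_zero_of_sum_ne_zero h
  exact ⟨k, left_ne_zero_of_mul hk, right_ne_zero_of_mul hk⟩

theorem relDiff_univ (d : Matrix I I ℝ) (f : I → ℝ) :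
    relDiff d.mulVecLin Set.univ f = d *ᵥ f := by
  funext i
  rw [relDiff_apply_of_mem (Set.mem_univ i), mulVecLin_apply]

variable [DecidableEq I] [DecidableEq J]

/-- A deformation retraction of the complex with differential `d` onto the image of `p`: the
projection `p` is homotopic to the identity through the homotopy `h`, and the differential vanishes
on the image of `p`. -/
structure IsRetract (deg : I → ℕ) (d p h : Matrix I I ℝ) : Prop where
  proj : p * p = p
  diff_mul : d * p = 0
  mul_diff : p * d = 0
  homotopy : p + (d * h + h * d) = 1
  proj_deg : ∀ i j, p i j ≠ 0 → deg i = deg j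
  homotopy_deg : ∀ i j, h i j ≠ 0 → deg j = deg i + 1

/-- The projection onto the retract has the cohomology as its image, so that its trace in each
degree is the dimension of the cohomology. -/
theorem IsRetract.cohDim_eq {deg : I → ℕ} {d p h : Matrix I I ℝ} (H : IsRetract deg d p h) (n : ℕ) :
    (cohDim d.mulVecLin deg Set.univ n : ℝ) = ∑ i, if deg i = n then p i i else 0 := by
  let c : Matrix I I ℝ := diagonal fun i => if deg i = n then 1 else 0
  have hc : ∀ f i, (c *ᵥ f) i = if deg i = n then f i else 0 := by
    intro f i
    rw [mulVec_diagonal]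
    simp
  have hcf : ∀ f ∈ cochainsOn deg Set.univ n, c *ᵥ f = f := by
    intro f hf
    funext i
    rw [hc]
    split_ifs with hi
    · rfl
    · by_contra hne
      exact hi (hf i (Ne.symm hne)).2
  have hcp : p * c * (p * c) = p * c := by
    have : c * p * c = p * c := by
      ext i j
      simp only [c, mul_diagonal, diagonal_mul]
      by_cases hij : p i j = 0
      · simp [hij]
      · rw [H.proj_deg i j hij]
        split_ifs <;> simp
    rw [Matrix.mul_assoc, ← Matrix.mul_assoc c, this, ← Matrix.mul_assoc, H.proj]
  have hidem : IsIdempotentElem (toLin' (p * c)) := by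
    change _ * _ = _
    rw [Module.End.mul_eq_comp, ← toLin'_mul, hcp]
  have hrange : ∀ z ∈ LinearMap.range (toLin' (p * c)),
      z ∈ cochainsOn deg Set.univ n ∧ p *ᵥ z = z := by
    rintro _ ⟨f, rfl⟩
    rw [toLin'_apply]
    constructor
    · intro i hi
      rw [← mulVec_mulVec] at hi
      obtain ⟨k, hk, hfk⟩ := exists_ne_zero_of_mulVec_apply_ne_zero hi
      rw [hc] at hfk
      refine ⟨Set.mem_univ i, (H.proj_deg i k hk).trans ?_⟩
      by_contra hne
      exact hfk (if_neg hne)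
    · rw [mulVec_mulVec, ← Matrix.mul_assoc, H.proj]
  have key : Module.finrank ℝ (LinearMap.range (toLin' (p * c))) =
      cohDim d.mulVecLin deg Set.univ n := by
    have hbot : (⊥ : Submodule ℝ (I → ℝ)).submoduleOf (LinearMap.range (toLin' (p * c))) = ⊥ := by
      rw [Submodule.submoduleOf, Submodule.comap_bot, Submodule.ker_subtype]
    rw [← (Submodule.quotEquivOfEqBot _ hbot).finrank_eq]
    refine finrank_quotient_eq_of_map LinearMap.id ?_ ?_ ?_
    · intro z hz
      obtain ⟨hz1, hz2⟩ := hrange z hz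
      refine ⟨hz1, ?_⟩
      rw [SetLike.mem_coe, LinearMap.mem_ker, LinearMap.id_apply, relDiff_univ, ← hz2,
        mulVec_mulVec, H.diff_mul, zero_mulVec]
    · intro z hz
      obtain ⟨hz1, hz2⟩ := hrange z hz
      rw [Submodule.mem_bot, LinearMap.id_apply]
      constructor
      · rintro ⟨g, -, hg⟩
        rw [relDiff_univ] at hg
        rw [← hz2, ← hg, mulVec_mulVec, H.mul_diff, zero_mulVec]
      · rintro rfl
        exact zero_mem _
    · rintro z ⟨hz, hz0⟩
      rw [SetLike.mem_coe, LinearMap.mem_ker, relDiff_univ] at hz0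
      refine ⟨p *ᵥ z, ⟨z, ?_⟩, h *ᵥ z, ?_, ?_⟩
      · rw [toLin'_apply, ← mulVec_mulVec, hcf z hz]
      · intro i hi
        obtain ⟨k, hk, hzk⟩ := exists_ne_zero_of_mulVec_apply_ne_zero hi
        exact ⟨Set.mem_univ i, (H.homotopy_deg i k hk).symm.trans (hz k hzk).2⟩
      · rw [relDiff_univ, LinearMap.id_apply, eq_sub_iff_add_eq']
        conv_rhs => rw [← one_mulVec z, ← H.homotopy, add_mulVec, add_mulVec, ← mulVec_mulVec,
          ← mulVec_mulVec, hz0, mulVec_zero, add_zero]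
  rw [← key, ← (LinearMap.IsIdempotentElem.isProj_range _ hidem).trace, Matrix.trace_toLin'_eq]
  simp only [trace, diag_apply, c, mul_diagonal]
  simp

/-- Every finite based complex over a field deformation retracts onto its cohomology. -/
theorem exists_isRetract {deg : I → ℕ} {d : Matrix I I ℝ} (hd : d * d = 0)
    (hdeg : ∀ i j, d i j ≠ 0 → deg i = deg j + 1) : ∃ p h, IsRetract deg d p h := by
  -- a generalised inverse of `d`
  obtain ⟨g, hg⟩ : ∃ g : Matrix I I ℝ, d * g * d = d := by
    obtain ⟨s, hs⟩ := (toLin' d).rangeRestrict.exists_rightInverse_of_surjective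
      (LinearMap.range_rangeRestrict _)
    obtain ⟨r, hr⟩ := (LinearMap.range (toLin' d)).subtype.exists_leftInverse_of_injective
      (Submodule.ker_subtype _)
    refine ⟨LinearMap.toMatrix' (s ∘ₗ r), ?_⟩
    apply toLin'.injective
    rw [toLin'_mul, toLin'_mul, toLin'_toMatrix']
    refine LinearMap.ext fun f => ?_
    have h1 : r (toLin' d f) = (toLin' d).rangeRestrict f :=
      LinearMap.congr_fun hr ((toLin' d).rangeRestrict f)
    have h2 := LinearMap.congr_fun hs ((toLin' d).rangeRestrict f)
    simp only [LinearMap.comp_apply, LinearMap.id_apply] at h2 ⊢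
    rw [h1]
    exact congrArg Subtype.val h2
  -- its component of degree `-1` is again a generalised inverse
  let k : Matrix I I ℝ := of fun i j => if deg j = deg i + 1 then g i j else 0
  have hkdeg : ∀ i j, k i j ≠ 0 → deg j = deg i + 1 := by
    intro i j h
    by_contra hne
    exact h (if_neg hne)
  have hk : d * k * d = d := by
    ext i j
    by_cases hij : deg i = deg j + 1
    · conv_rhs => rw [← hg]
      simp only [mul_apply]
      refine Finset.sum_congr rfl fun b _ => ?_
      by_cases hb : d b j = 0
      · rw [hb, mul_zero, mul_zero]
      congr 1
      refine Finset.sum_congr rfl fun a _ => ?_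
      by_cases ha : d i a = 0
      · rw [ha, zero_mul, zero_mul]
      congr 1
      refine if_pos ?_
      have := hdeg _ _ ha
      have := hdeg _ _ hb
      omega
    · have h0 : d i j = 0 := by
        by_contra h
        exact hij (hdeg i j h)
      rw [h0]
      by_contra h
      obtain ⟨b, hb, hbj⟩ := exists_ne_zero_of_mul_apply_ne_zero h
      obtain ⟨a, ha, hab⟩ := exists_ne_zero_of_mul_apply_ne_zero hb
      have := hdeg _ _ ha
      have := hdeg _ _ hbj
      have := hkdeg _ _ hab
      omega
  -- correcting `k` by a term that vanishes on the image of `d` makes the projection idempotent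
  have e1 : ∀ x : Matrix I I ℝ, d * (d * x) = 0 := fun x => by
    rw [← Matrix.mul_assoc, hd, Matrix.zero_mul]
  have e2 : d * (k * d) = d := by rw [← Matrix.mul_assoc, hk]
  have e3 : ∀ x : Matrix I I ℝ, d * (k * (d * x)) = d * x := fun x => by
    rw [← Matrix.mul_assoc k, ← Matrix.mul_assoc d, ← Matrix.mul_assoc d, hk]
  refine ⟨1 - d * k - k * d + d * k * k * d, k - k * k * d, ?_, ?_, ?_, ?_, ?_, ?_⟩
  · simp only [Matrix.mul_add, Matrix.mul_sub, Matrix.add_mul, Matrix.sub_mul, Matrix.mul_assoc,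
      Matrix.one_mul, Matrix.mul_one, e1, e2, e3, Matrix.mul_zero]
    abel
  · simp only [Matrix.mul_add, Matrix.mul_sub, Matrix.mul_assoc, Matrix.mul_one, e1, e2]
    abel
  · simp only [Matrix.add_mul, Matrix.sub_mul, Matrix.mul_assoc, Matrix.one_mul, hd, e2,
      Matrix.mul_zero]
    abel
  · simp only [Matrix.mul_sub, Matrix.sub_mul, Matrix.mul_assoc, hd, Matrix.mul_zero]
    abel
  · intro i j h
    by_contra hij
    have h1 : (1 : Matrix I I ℝ) i j = 0 := one_apply_ne fun h => hij (congrArg deg h)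
    have h2 : (d * k) i j = 0 := by
      by_contra h
      obtain ⟨a, ha, hb⟩ := exists_ne_zero_of_mul_apply_ne_zero h
      have := hdeg _ _ ha
      have := hkdeg _ _ hb
      omega
    have h3 : (k * d) i j = 0 := by
      by_contra h
      obtain ⟨a, ha, hb⟩ := exists_ne_zero_of_mul_apply_ne_zero h
      have := hkdeg _ _ ha
      have := hdeg _ _ hb
      omega
    have h4 : (d * k * k * d) i j = 0 := by
      by_contra h
      obtain ⟨a, ha, h5⟩ := exists_ne_zero_of_mul_apply_ne_zero h
      obtain ⟨b, hb, h6⟩ := exists_ne_zero_of_mul_apply_ne_zero ha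
      obtain ⟨c, hc, h7⟩ := exists_ne_zero_of_mul_apply_ne_zero hb
      have := hdeg _ _ hc
      have := hkdeg _ _ h7
      have := hkdeg _ _ h6
      have := hdeg _ _ h5
      omega
    exact h (by simp [h1, h2, h3, h4])
  · intro i j h
    by_contra hij
    have h1 : k i j = 0 := by
      by_contra h
      exact hij (hkdeg i j h)
    have h2 : (k * k * d) i j = 0 := by
      by_contra h
      obtain ⟨a, ha, h5⟩ := exists_ne_zero_of_mul_apply_ne_zero h
      obtain ⟨b, hb, h6⟩ := exists_ne_zero_of_mul_apply_ne_zero ha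
      have := hkdeg _ _ hb
      have := hkdeg _ _ h6
      have := hdeg _ _ h5
      omega
    exact h (by simp [h1, h2])

/-- The sign operator of a graded space. -/
def signMatrix (deg : I → ℕ) : Matrix I I ℝ := diagonal fun i => (-1) ^ deg i

/-- The differential of the tensor product of two based complexes. -/
def tensorDiff (deg : I → ℕ) (d : Matrix I I ℝ) (d' : Matrix J J ℝ) :
    Matrix (I × J) (I × J) ℝ :=
  d ⊗ₖ 1 + signMatrix deg ⊗ₖ d'

/-- The tensor product of two retractions onto cohomology. -/
theorem IsRetract.tensor {deg : I → ℕ} {d p h : Matrix I I ℝ} {deg' : J → ℕ}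
    {d' p' h' : Matrix J J ℝ}
    (H : IsRetract deg d p h) (H' : IsRetract deg' d' p' h')
    (hdeg : ∀ i j, d i j ≠ 0 → deg i = deg j + 1) :
    IsRetract (fun x : I × J => deg x.1 + deg' x.2) (tensorDiff deg d d') (p ⊗ₖ p')
      (h ⊗ₖ 1 + (signMatrix deg * p) ⊗ₖ h') := by
  have hs : signMatrix deg * signMatrix deg = 1 := by
    rw [signMatrix, diagonal_mul_diagonal, ← diagonal_one]
    congr 1
    funext i
    rw [← mul_pow]
    norm_num
  have hanti : ∀ a : Matrix I I ℝ, (∀ i j, a i j ≠ 0 → deg i = deg j + 1 ∨ deg j = deg i + 1) →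
      signMatrix deg * a = -(a * signMatrix deg) := by
    intro a ha
    ext i j
    rw [neg_apply, signMatrix, diagonal_mul, mul_diagonal]
    by_cases h0 : a i j = 0
    · simp [h0]
    · rcases ha i j h0 with h | h <;> rw [h, pow_succ] <;> ring
  have hsd := hanti d fun i j hij => Or.inl (hdeg i j hij)
  have hsh := hanti h fun i j hij => Or.inr (H.homotopy_deg i j hij)
  have hsp : p * signMatrix deg = signMatrix deg * p := by
    ext i j
    rw [signMatrix, diagonal_mul, mul_diagonal]
    by_cases h0 : p i j = 0
    · simp [h0]
    · rw [H.proj_deg i j h0, mul_comm]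
  have hdsp : d * (signMatrix deg * p) = 0 := by
    rw [← hsp, ← Matrix.mul_assoc, H.diff_mul, Matrix.zero_mul]
  have hspd : signMatrix deg * p * d = 0 := by
    rw [Matrix.mul_assoc, H.mul_diff, Matrix.mul_zero]
  have hssp : signMatrix deg * (signMatrix deg * p) = p := by
    rw [← Matrix.mul_assoc, hs, Matrix.one_mul]
  have hsps : signMatrix deg * p * signMatrix deg = p := by
    rw [Matrix.mul_assoc, hsp, hssp]
  have hdeg1 : ∀ (a : Matrix I I ℝ) (b : Matrix J J ℝ) x y, (a ⊗ₖ b) x y ≠ 0 →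
      a x.1 y.1 ≠ 0 ∧ b x.2 y.2 ≠ 0 := by
    intro a b x y hxy
    rw [kronecker_apply] at hxy
    exact ⟨left_ne_zero_of_mul hxy, right_ne_zero_of_mul hxy⟩
  refine ⟨?_, ?_, ?_, ?_, ?_, ?_⟩
  · rw [← mul_kronecker_mul, H.proj, H'.proj]
  · rw [tensorDiff, Matrix.add_mul, ← mul_kronecker_mul, ← mul_kronecker_mul, H.diff_mul,
      H'.diff_mul, zero_kronecker, kronecker_zero, add_zero]
  · rw [tensorDiff, Matrix.mul_add, ← mul_kronecker_mul, ← mul_kronecker_mul, H.mul_diff,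
      H'.mul_diff, zero_kronecker, kronecker_zero, add_zero]
  · have e1 : tensorDiff deg d d' * (h ⊗ₖ 1 + (signMatrix deg * p) ⊗ₖ h') =
        (d * h) ⊗ₖ 1 + (signMatrix deg * h) ⊗ₖ d' + p ⊗ₖ (d' * h') := by
      rw [tensorDiff, Matrix.add_mul, Matrix.mul_add, Matrix.mul_add, ← mul_kronecker_mul,
        ← mul_kronecker_mul, ← mul_kronecker_mul, ← mul_kronecker_mul, hdsp, hssp,
        zero_kronecker, add_zero, Matrix.mul_one, Matrix.mul_one, add_assoc]
    have e2 : (h ⊗ₖ 1 + (signMatrix deg * p) ⊗ₖ h') * tensorDiff deg d d' =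
        (h * d) ⊗ₖ 1 - (signMatrix deg * h) ⊗ₖ d' + p ⊗ₖ (h' * d') := by
      rw [tensorDiff, Matrix.add_mul, Matrix.mul_add, Matrix.mul_add, ← mul_kronecker_mul,
        ← mul_kronecker_mul, ← mul_kronecker_mul, ← mul_kronecker_mul, hspd, hsps,
        zero_kronecker, zero_add, Matrix.mul_one, Matrix.one_mul, hsh, ← neg_one_smul ℝ (h * _),
        smul_kronecker, neg_one_smul, sub_neg_eq_add]
    rw [e1, e2]
    have e3 : (1 : Matrix (I × J) (I × J) ℝ) =
        p ⊗ₖ p' + ((d * h) ⊗ₖ 1 + (h * d) ⊗ₖ 1 + (p ⊗ₖ (d' * h') + p ⊗ₖ (h' * d'))) := by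
      rw [← kronecker_add, ← add_kronecker]
      have h1 := eq_sub_of_add_eq' H.homotopy
      have h2 := eq_sub_of_add_eq' H'.homotopy
      rw [add_left_comm, ← kronecker_add, H'.homotopy, ← add_kronecker, add_comm _ p, H.homotopy,
        one_kronecker_one]
    rw [e3]
    abel
  · intro x y hxy
    obtain ⟨h1, h2⟩ := hdeg1 _ _ _ _ hxy
    rw [H.proj_deg _ _ h1, H'.proj_deg _ _ h2]
  · intro x y hxy
    by_cases h0 : (h ⊗ₖ (1 : Matrix J J ℝ)) x y = 0
    · rw [Matrix.add_apply, h0, zero_add] at hxy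
      obtain ⟨h1, h2⟩ := hdeg1 _ _ _ _ hxy
      rw [signMatrix, diagonal_mul] at h1
      rw [H.proj_deg _ _ (right_ne_zero_of_mul h1), H'.homotopy_deg _ _ h2, add_assoc]
    · obtain ⟨h1, h2⟩ := hdeg1 _ _ _ _ h0
      have h3 : x.2 = y.2 := by
        by_contra hne
        exact h2 (one_apply_ne hne)
      rw [H.homotopy_deg _ _ h1, h3]
      omega

/-- The Künneth formula for the tensor product of two finite based complexes over a field. -/
theorem cohDim_tensorDiff {deg : I → ℕ} {d : Matrix I I ℝ} {deg' : J → ℕ} {d' : Matrix J J ℝ}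
    (hd : d * d = 0) (hdeg : ∀ i j, d i j ≠ 0 → deg i = deg j + 1)
    (hd' : d' * d' = 0) (hdeg' : ∀ i j, d' i j ≠ 0 → deg' i = deg' j + 1) (n : ℕ) :
    cohDim (tensorDiff deg d d').mulVecLin (fun x : I × J => deg x.1 + deg' x.2) Set.univ n =
      ∑ ab ∈ Finset.HasAntidiagonal.antidiagonal n,
        cohDim d.mulVecLin deg Set.univ ab.1 * cohDim d'.mulVecLin deg' Set.univ ab.2 := by
  obtain ⟨p, h, H⟩ := exists_isRetract hd hdeg
  obtain ⟨p', h', H'⟩ := exists_isRetract hd' hdeg'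
  have : (cohDim (tensorDiff deg d d').mulVecLin (fun x : I × J => deg x.1 + deg' x.2) Set.univ n :
      ℝ) = ∑ ab ∈ Finset.HasAntidiagonal.antidiagonal n,
        (cohDim d.mulVecLin deg Set.univ ab.1 : ℝ) * cohDim d'.mulVecLin deg' Set.univ ab.2 := by
    rw [(H.tensor H' hdeg).cohDim_eq]
    simp only [H.cohDim_eq, H'.cohDim_eq, Finset.sum_mul_sum]
    rw [Finset.sum_comm, Fintype.sum_prod_type]
    refine Finset.sum_congr rfl fun i _ => ?_
    rw [Finset.sum_comm]
    refine Finset.sum_congr rfl fun j _ => ?_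
    rw [kronecker_apply]
    split_ifs with hij
    · rw [Finset.sum_eq_single (deg i, deg' j)]
      · simp
      · rintro ⟨a, b⟩ - hne
        by_cases ha : deg i = a
        · rw [if_neg (c := deg' j = b), mul_zero]
          rintro rfl
          exact hne (by rw [ha])
        · rw [if_neg ha, zero_mul]
      · intro hne
        exact absurd (Finset.HasAntidiagonal.mem_antidiagonal.2 hij) hne
    · refine (Finset.sum_eq_zero ?_).symm
      rintro ⟨a, b⟩ hab
      rw [Finset.HasAntidiagonal.mem_antidiagonal] at hab
      by_cases ha : deg i = a
      · rw [if_neg (c := deg' j = b), mul_zero]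
        rintro rfl
        exact hij (by rw [ha]; exact hab)
      · rw [if_neg ha, zero_mul]
  exact_mod_cast this

end Kuenneth

/-! ### Relative simplicial cochains as functions on finite sets -/

section Simplicial

variable {U : Type u} (ρ : U → ℕ)

/-- The sign `(-1) ^ i` of the vertex `v` in `s`, where `i` is the position of `v` when `s` is
ordered by the injective rank function `ρ`. -/
def vertexSign (v : U) (s : Finset U) : ℝ := (-1) ^ (s.filter fun u => ρ u < ρ v).card

theorem vertexSign_mul_self {ρ : U → ℕ} (v : U) (s : Finset U) :
    vertexSign ρ v s * vertexSign ρ v s = 1 := by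
  rw [vertexSign, ← mul_pow]
  norm_num

variable [DecidableEq U]

/-- The simplicial coboundary on functions of finite sets of vertices, which are oriented by the
rank function `ρ`. -/
def simplicialDiff : (Finset U → ℝ) →ₗ[ℝ] (Finset U → ℝ) where
  toFun f s := ∑ v ∈ s, vertexSign ρ v s * f (s.erase v)
  map_add' f g := by
    funext s
    simp [mul_add, Finset.sum_add_distrib]
  map_smul' c f := by
    funext s
    simp [Finset.mul_sum, mul_left_comm]

theorem simplicialDiff_apply (f : Finset U → ℝ) (s : Finset U) :
    simplicialDiff ρ f s = ∑ v ∈ s, vertexSign ρ v s * f (s.erase v) :=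
  rfl

variable {ρ}

theorem vertexSign_eq_mul_erase {v : U} {s : Finset U} (hv : v ∈ s) (w : U) :
    vertexSign ρ w s = vertexSign ρ w (s.erase v) * if ρ v < ρ w then -1 else 1 := by
  rw [vertexSign, vertexSign, Finset.filter_erase]
  split_ifs with h
  · rw [← pow_succ, Finset.card_erase_add_one (Finset.mem_filter.2 ⟨hv, h⟩)]
  · rw [mul_one, Finset.erase_eq_of_notMem]
    exact fun h' => h (Finset.mem_filter.1 h').2

theorem vertexSign_erase_self {v : U} {s : Finset U} (hv : v ∈ s) :
    vertexSign ρ v (s.erase v) = vertexSign ρ v s := by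
  rw [vertexSign_eq_mul_erase hv v, if_neg (lt_irrefl _), mul_one]

theorem vertexSign_anticomm (hρ : Function.Injective ρ) {v w : U} {s : Finset U} (hvw : v ≠ w)
    (hv : v ∈ s) (hw : w ∈ s) :
    vertexSign ρ v s * vertexSign ρ w (s.erase v) =
      -(vertexSign ρ w s * vertexSign ρ v (s.erase w)) := by
  rw [vertexSign_eq_mul_erase hv w, vertexSign_eq_mul_erase hw v]
  rcases lt_or_gt_of_ne (hρ.ne hvw) with h | h
  · rw [if_pos h, if_neg h.not_gt]
    ring
  · rw [if_pos h, if_neg h.not_gt]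
    ring

theorem raisesDegree_simplicialDiff : RaisesDegree (simplicialDiff ρ) Finset.card := by
  intro f s h
  obtain ⟨v, hv, hne⟩ := Finset.exists_ne_zero_of_sum_ne_zero h
  exact ⟨s.erase v, right_ne_zero_of_mul hne, (Finset.card_erase_add_one hv).symm⟩

/-- The coboundary squares to zero on the relative cochains of an order-convex family. -/
theorem isComplexOn_simplicialDiff (hρ : Function.Injective ρ) {S : Set (Finset U)}
    (hS : S.OrdConnected) : IsComplexOn (simplicialDiff ρ) S := by
  intro f hf
  funext s
  by_cases hs : s ∈ S
  swap
  · exact relDiff_apply_of_notMem hs _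
  rw [relDiff_apply_of_mem hs, simplicialDiff_apply, Pi.zero_apply]
  have h1 : ∀ v ∈ s, vertexSign ρ v s * relDiff (simplicialDiff ρ) S f (s.erase v) =
      ∑ w ∈ s.erase v, vertexSign ρ v s * vertexSign ρ w (s.erase v) * f ((s.erase v).erase w) := by
    intro v _
    by_cases hvS : s.erase v ∈ S
    · rw [relDiff_apply_of_mem hvS, simplicialDiff_apply, Finset.mul_sum]
      simp only [mul_assoc]
    · rw [relDiff_apply_of_notMem hvS, mul_zero]
      refine (Finset.sum_eq_zero fun w _ => ?_).symm
      have : f ((s.erase v).erase w) = 0 := by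
        by_contra h
        exact hvS (hS.out (hf _ h) hs ⟨Finset.erase_subset _ _, Finset.erase_subset _ _⟩)
      rw [this, mul_zero]
  rw [Finset.sum_congr rfl h1]
  -- the summand is antisymmetric in the two removed vertices
  have h2 : (∑ v ∈ s, ∑ w ∈ s.erase v,
        vertexSign ρ v s * vertexSign ρ w (s.erase v) * f ((s.erase v).erase w)) =
      -∑ v ∈ s, ∑ w ∈ s.erase v,
        vertexSign ρ v s * vertexSign ρ w (s.erase v) * f ((s.erase v).erase w) := by
    conv_lhs => rw [Finset.sum_comm' (t' := s) (s' := fun w => s.erase w) (by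
      intro v w
      simp only [Finset.mem_erase]
      tauto)]
    rw [← Finset.sum_neg_distrib]
    refine Finset.sum_congr rfl fun w hw => ?_
    rw [← Finset.sum_neg_distrib]
    refine Finset.sum_congr rfl fun v hv => ?_
    rw [Finset.mem_erase] at hv
    rw [vertexSign_anticomm hρ hv.1 hv.2 hw, Finset.erase_right_comm, neg_mul]
  linarith

/-- A family of finite sets is acyclic if each of its members can be coned off. The apex has to have
a colour `c`, and to depend only on the vertices of the other colours. -/
theorem cocyclesOn_le_coboundariesOn_of_apex [Finite U] (hρ : Function.Injective ρ)
    {S : Set (Finset U)} (hS : S.OrdConnected) (c : U → Prop) [DecidablePred c]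
    (apex : Finset U → U) (hc : ∀ s ∈ S, c (apex s))
    (hins : ∀ s ∈ S, insert (apex s) s ∈ S) (hera : ∀ s ∈ S, s.erase (apex s) ∈ S)
    (hapex : ∀ s t : Finset U, (s.filter fun u => ¬ c u) = (t.filter fun u => ¬ c u) →
      apex s = apex t) (n : ℕ) :
    cocyclesOn (simplicialDiff ρ) Finset.card S n ≤
      coboundariesOn (simplicialDiff ρ) Finset.card S n := by
  let r : Finset U → ℕ := fun s => (s.filter fun u => ¬ c u).card
  have hrle : ∀ s, r s ≤ Nat.card U := by
    intro s
    have := Fintype.ofFinite U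
    rw [Nat.card_eq_fintype_card]
    exact Finset.card_le_univ _
  have hf_insert : ∀ (v : U) (s : Finset U), c v →
      ((insert v s).filter fun u => ¬ c u) = s.filter fun u => ¬ c u := by
    intro v s hv
    rw [Finset.filter_insert, if_neg (not_not.2 hv)]
  have hf_erase : ∀ (v : U) (s : Finset U), c v →
      ((s.erase v).filter fun u => ¬ c u) = s.filter fun u => ¬ c u := by
    intro v s hv
    rw [Finset.filter_erase, Finset.erase_eq_of_notMem]
    exact fun h => (Finset.mem_filter.1 h).2 hv
  have hr_erase : ∀ (v : U) (s : Finset U), v ∈ s → ¬ c v → r (s.erase v) + 1 = r s := by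
    intro v s hv hcv
    simp only [r]
    rw [Finset.filter_erase, Finset.card_erase_add_one (Finset.mem_filter.2 ⟨hv, hcv⟩)]
  have hcomp := isComplexOn_simplicialDiff hρ hS
  -- Downward induction on the least number of vertices of other colours in the support.
  suffices H : ∀ k m : ℕ, m + k = Nat.card U + 1 →
      ∀ f ∈ cocyclesOn (simplicialDiff ρ) Finset.card S n, (∀ s, f s ≠ 0 → m ≤ r s) →
        f ∈ coboundariesOn (simplicialDiff ρ) Finset.card S n from
    fun f hf => H _ 0 (Nat.zero_add _) f hf fun _ _ => Nat.zero_le _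
  intro k
  induction k with
  | zero =>
    intro m hm f _ hfm
    have : f = 0 := by
      funext s
      by_contra h
      have := hfm s h
      have := hrle s
      omega
    rw [this]
    exact zero_mem _
  | succ k ih =>
    intro m hm f hf hfm
    obtain ⟨hfS, hf0⟩ := mem_cocyclesOn.1 hf
    classical
    let g : Finset U → ℝ := fun s =>
      if s ∈ S ∧ apex s ∉ s then vertexSign ρ (apex s) s * f (insert (apex s) s) else 0
    have hg_pos : ∀ s, s ∈ S → apex s ∉ s →
        g s = vertexSign ρ (apex s) s * f (insert (apex s) s) := fun s h1 h2 => if_pos ⟨h1, h2⟩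
    have hg_ne : ∀ s, g s ≠ 0 → s ∈ S ∧ apex s ∉ s ∧ f (insert (apex s) s) ≠ 0 := by
      intro s hs
      by_cases h : s ∈ S ∧ apex s ∉ s
      · rw [hg_pos s h.1 h.2] at hs
        exact ⟨h.1, h.2, right_ne_zero_of_mul hs⟩
      · exact absurd (if_neg h) hs
    have hg : relDiff (simplicialDiff ρ) S g ∈
        coboundariesOn (simplicialDiff ρ) Finset.card S n := by
      refine ⟨g, fun s hs => ?_, rfl⟩
      obtain ⟨h1, h2, h3⟩ := hg_ne s hs
      refine ⟨h1, ?_⟩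
      rw [← (hfS _ h3).2, Finset.card_insert_of_notMem h2]
    rw [← sub_add_cancel f (relDiff (simplicialDiff ρ) S g)]
    refine add_mem (ih (m + 1) (by omega) _ ?_ ?_) hg
    · exact sub_mem hf (coboundariesOn_le_cocyclesOn raisesDegree_simplicialDiff hcomp hg)
    intro s hs
    by_contra hrs
    rw [not_le] at hrs
    apply hs
    by_cases hsS : s ∈ S
    swap
    · rw [Pi.sub_apply, relDiff_apply_of_notMem hsS, sub_zero]
      by_contra h
      exact hsS (hfS s h).1
    rw [Pi.sub_apply, relDiff_apply_of_mem hsS, simplicialDiff_apply, sub_eq_zero]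
    have hcv := hc s hsS
    -- faces opposite to a vertex of another colour do not contribute
    have hg_other : ∀ u ∈ s, ¬ c u → g (s.erase u) = 0 := by
      intro u hu hcu
      by_contra h
      obtain ⟨h1, -, h3⟩ := hg_ne _ h
      have h4 := hfm _ h3
      have h5 : r (insert (apex (s.erase u)) (s.erase u)) = r (s.erase u) :=
        congrArg Finset.card (hf_insert _ _ (hc _ h1))
      have := hr_erase u s hu hcu
      omega
    have happ : ∀ u, c u → apex (s.erase u) = apex s := fun u hu => hapex _ _ (hf_erase u s hu)
    by_cases hvs : apex s ∈ s
    · rw [Finset.sum_eq_single (apex s)]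
      · have h1 : apex (s.erase (apex s)) = apex s := happ _ hcv
        rw [hg_pos _ (hera s hsS) (by rw [h1]; exact Finset.notMem_erase _ _), h1,
          Finset.insert_erase hvs, vertexSign_erase_self hvs, ← mul_assoc, vertexSign_mul_self,
          one_mul]
      · intro u hu hne
        have : g (s.erase u) = 0 := by
          by_cases hcu : c u
          · by_contra h
            apply (hg_ne _ h).2.1
            rw [happ u hcu]
            exact Finset.mem_erase.2 ⟨hne.symm, hvs⟩
          · exact hg_other u hu hcu
        rw [this, mul_zero]
      · exact fun h => absurd hvs h
    · have hcoc := hf0 _ (hins s hsS)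
      have hvt : vertexSign ρ (apex s) (insert (apex s) s) = vertexSign ρ (apex s) s := by
        rw [← vertexSign_erase_self (Finset.mem_insert_self _ _), Finset.erase_insert hvs]
      rw [simplicialDiff_apply, Finset.sum_insert hvs, Finset.erase_insert hvs] at hcoc
      have hterm : ∀ u ∈ s, vertexSign ρ u s * g (s.erase u) =
          -(vertexSign ρ (apex s) (insert (apex s) s) *
            (vertexSign ρ u (insert (apex s) s) * f ((insert (apex s) s).erase u))) := by
        intro u hu
        have hne : apex s ≠ u := by
          rintro rfl
          exact hvs hu
        by_cases hcu : c u
        · have herase : (insert (apex s) s).erase u = insert (apex s) (s.erase u) :=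
            Finset.erase_insert_of_ne hne
          have hvu : apex s ∉ s.erase u := fun h => hvs (Finset.mem_of_mem_erase h)
          rw [herase]
          by_cases hfz : f (insert (apex s) (s.erase u)) = 0
          · have : g (s.erase u) = 0 := by
              by_contra h
              apply (hg_ne _ h).2.2
              rwa [happ u hcu]
            rw [this, hfz]
            simp
          · have hmem := hera _ (hfS _ hfz).1
            have h1 : apex (insert (apex s) (s.erase u)) = apex s :=
              (hapex _ _ (hf_insert _ _ hcv)).trans (happ u hcu)
            rw [h1, Finset.erase_insert hvu] at hmem
            rw [hg_pos _ hmem (by rwa [happ u hcu]), happ u hcu]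
            have ha := vertexSign_anticomm hρ hne (Finset.mem_insert_self (apex s) s)
              (Finset.mem_insert_of_mem hu)
            rw [Finset.erase_insert hvs, herase, ← vertexSign_erase_self
              (Finset.mem_insert_self (apex s) (s.erase u)), Finset.erase_insert hvu] at ha
            have hA := vertexSign_mul_self (ρ := ρ) (apex s) (insert (apex s) s)
            have hD := vertexSign_mul_self (ρ := ρ) (apex s) (s.erase u)
            linear_combination (vertexSign ρ (apex s) (insert (apex s) s) *
                vertexSign ρ (apex s) (s.erase u) * f (insert (apex s) (s.erase u))) * ha -
              vertexSign ρ u s * vertexSign ρ (apex s) (s.erase u) *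
                f (insert (apex s) (s.erase u)) * hA -
              vertexSign ρ (apex s) (insert (apex s) s) * vertexSign ρ u (insert (apex s) s) *
                f (insert (apex s) (s.erase u)) * hD
        · have : f ((insert (apex s) s).erase u) = 0 := by
            by_contra h
            have h1 := hfm _ h
            have h2 := hr_erase u (insert (apex s) s) (Finset.mem_insert_of_mem hu) hcu
            have h3 : r (insert (apex s) s) = r s := congrArg Finset.card (hf_insert _ _ hcv)
            omega
          rw [hg_other u hu hcu, this]
          simp
      rw [Finset.sum_congr rfl hterm, Finset.sum_neg_distrib, ← Finset.mul_sum]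
      have hA := vertexSign_mul_self (ρ := ρ) (apex s) (insert (apex s) s)
      linear_combination vertexSign ρ (apex s) (insert (apex s) s) * hcoc - f s * hA

end Simplicial

/-! ### Alternating cochains and functions on cliques -/

section CliqueComplex

variable {V : Type u} (G : SimpleGraph V)

/-- The simplices of the clique complex: the non-empty finite cliques. -/
def cliqueFamily : Set (Finset V) := {s | s.Nonempty ∧ G.IsClique s}

variable {G}

theorem ordConnected_cliqueFamily : (cliqueFamily G).OrdConnected :=
  ⟨fun _ hs _ ht _ hr => ⟨hs.1.mono hr.1, ht.2.subset (Finset.coe_subset.2 hr.2)⟩⟩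

variable {ρ : V → ℕ}

/-- The clique tuple `x` lists the elements of `s` in increasing order of rank. -/
def CliqueTuple.Lists {n : ℕ} (ρ : V → ℕ) (x : CliqueTuple G n) (s : Finset V) : Prop :=
  StrictMono (ρ ∘ x.1) ∧ Set.range x.1 = s

theorem CliqueTuple.Lists.eq (hρ : Function.Injective ρ) {n : ℕ} {x y : CliqueTuple G n}
    {s : Finset V} (hx : x.Lists ρ s) (hy : y.Lists ρ s) : x = y := by
  have h : Set.range (ρ ∘ x.1) = Set.range (ρ ∘ y.1) := by
    rw [Set.range_comp, Set.range_comp, hx.2, hy.2]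
  exact Subtype.ext (hρ.comp_left ((hx.1.range_inj hy.1).1 h))

theorem CliqueTuple.Lists.injective {n : ℕ} {x : CliqueTuple G n} {s : Finset V}
    (hx : x.Lists ρ s) : Function.Injective x.1 :=
  hx.1.injective.of_comp

theorem CliqueTuple.Lists.card_eq {n : ℕ} {x : CliqueTuple G n} {s : Finset V}
    (hx : x.Lists ρ s) : s.card = n := by
  have h := Nat.card_range_of_injective hx.injective
  rw [hx.2, Nat.card_eq_card_toFinset] at h
  simpa using h

theorem CliqueTuple.Lists.isClique {n : ℕ} {x : CliqueTuple G n} {s : Finset V}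
    (hx : x.Lists ρ s) : G.IsClique (s : Set V) :=
  hx.2 ▸ x.2

theorem exists_lists (hρ : Function.Injective ρ) {n : ℕ} {s : Finset V} (hs : s.card = n)
    (hG : G.IsClique (s : Set V)) : ∃ x : CliqueTuple G n, x.Lists ρ s := by
  have hcard : (s.map ⟨ρ, hρ⟩).card = n := by rw [Finset.card_map, hs]
  have h : ∀ i, ∃ v ∈ s, ρ v = (s.map ⟨ρ, hρ⟩).orderEmbOfFin hcard i := fun i =>
    Finset.mem_map.1 (Finset.orderEmbOfFin_mem _ hcard i)
  choose x hxs hx using h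
  have hmono : StrictMono (ρ ∘ x) := by
    intro i j hij
    simp only [Function.comp_apply, hx]
    exact ((s.map ⟨ρ, hρ⟩).orderEmbOfFin hcard).strictMono hij
  have hrange : Set.range x = s := by
    apply Set.Subset.antisymm
    · rintro _ ⟨i, rfl⟩
      exact hxs i
    · intro v hv
      have : ρ v ∈ Set.range ((s.map ⟨ρ, hρ⟩).orderEmbOfFin hcard) := by
        rw [Finset.range_orderEmbOfFin]
        exact Finset.mem_map_of_mem ⟨ρ, hρ⟩ hv
      obtain ⟨i, hi⟩ := this
      exact ⟨i, hρ ((hx i).trans hi)⟩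
  exact ⟨⟨x, hrange.symm ▸ hG⟩, hmono, hrange⟩

open scoped Classical in
/-- The restriction of a function of clique tuples to the increasing tuples, as a function of finite
sets, extended by zero to the finite sets which are not cliques of size `n`. -/
def onCliques (G : SimpleGraph V) (ρ : V → ℕ) (n : ℕ) :
    (CliqueTuple G n → ℝ) →ₗ[ℝ] (Finset V → ℝ) where
  toFun f s := if h : ∃ x : CliqueTuple G n, x.Lists ρ s then f h.choose else 0
  map_add' f g := by
    funext s
    by_cases h : ∃ x : CliqueTuple G n, x.Lists ρ s <;> simp [h]
  map_smul' c f := by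
    funext s
    by_cases h : ∃ x : CliqueTuple G n, x.Lists ρ s <;> simp [h]

theorem onCliques_apply (hρ : Function.Injective ρ) {n : ℕ} {x : CliqueTuple G n} {s : Finset V}
    (hx : x.Lists ρ s) (f : CliqueTuple G n → ℝ) : onCliques G ρ n f s = f x := by
  have h : ∃ x : CliqueTuple G n, x.Lists ρ s := ⟨x, hx⟩
  exact (dif_pos h).trans (congrArg f (h.choose_spec.eq hρ hx))

theorem onCliques_ne_zero {n : ℕ} {f : CliqueTuple G n → ℝ} {s : Finset V}
    (h : onCliques G ρ n f s ≠ 0) : ∃ x : CliqueTuple G n, x.Lists ρ s := by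
  by_contra hx
  exact h (dif_neg hx)

theorem onCliques_mem_cochainsOn {k : ℕ} (f : CliqueTuple G (k + 1) → ℝ) :
    onCliques G ρ (k + 1) f ∈ cochainsOn Finset.card (cliqueFamily G) (k + 1) := by
  intro s hs
  obtain ⟨x, hx⟩ := onCliques_ne_zero hs
  refine ⟨⟨?_, hx.isClique⟩, hx.card_eq⟩
  rw [← Finset.card_pos, hx.card_eq]
  exact Nat.succ_pos k

theorem CliqueTuple.Lists.comp_succAbove [DecidableEq V] {n : ℕ} {x : CliqueTuple G (n + 1)}
    {s : Finset V} (hx : x.Lists ρ s) (i : Fin (n + 1)) :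
    (x.comp i.succAbove).Lists ρ (s.erase (x.1 i)) := by
  refine ⟨hx.1.comp (Fin.strictMono_succAbove i), ?_⟩
  change Set.range (x.1 ∘ i.succAbove) = _
  rw [Set.range_comp, Fin.range_succAbove, Finset.coe_erase, ← hx.2,
    Set.image_compl_eq_range_sdiff_image hx.injective, Set.image_singleton]

theorem CliqueTuple.Lists.vertexSign_eq {n : ℕ} {x : CliqueTuple G n}
    {s : Finset V} (hx : x.Lists ρ s) (i : Fin n) : vertexSign ρ (x.1 i) s = (-1) ^ (i : ℕ) := by
  have h : (s.filter fun u => ρ u < ρ (x.1 i)) = (Finset.Iio i).map ⟨x.1, hx.injective⟩ := by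
    ext u
    rw [Finset.mem_filter, ← Finset.mem_coe, ← hx.2]
    simp only [Finset.mem_map, Finset.mem_Iio, Function.Embedding.coeFn_mk]
    constructor
    · rintro ⟨⟨j, rfl⟩, hj⟩
      exact ⟨j, hx.1.lt_iff_lt.1 hj, rfl⟩
    · rintro ⟨j, hj, rfl⟩
      exact ⟨⟨j, rfl⟩, hx.1 hj⟩
  rw [vertexSign, h, Finset.card_map, Fin.card_Iio]

theorem onCliques_coboundary [DecidableEq V] (hρ : Function.Injective ρ) (n : ℕ)
    (f : CliqueTuple G n → ℝ) :
    relDiff (simplicialDiff ρ) (cliqueFamily G) (onCliques G ρ n f) =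
      onCliques G ρ (n + 1) (coboundary G n f) := by
  funext s
  by_cases h : ∃ x : CliqueTuple G (n + 1), x.Lists ρ s
  · obtain ⟨x, hx⟩ := h
    have hs : s ∈ cliqueFamily G := by
      refine ⟨?_, hx.isClique⟩
      rw [← Finset.card_pos, hx.card_eq]
      exact Nat.succ_pos n
    have hmap : s = Finset.univ.map ⟨x.1, hx.injective⟩ := by
      apply Finset.coe_injective
      rw [← hx.2]
      simp
    rw [relDiff_apply_of_mem hs, simplicialDiff_apply, onCliques_apply hρ hx, coboundary_apply]
    conv_lhs => rw [Finset.sum_congr hmap fun _ _ => rfl, Finset.sum_map]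
    refine Finset.sum_congr rfl fun i _ => ?_
    simp only [Function.Embedding.coeFn_mk]
    rw [hx.vertexSign_eq, onCliques_apply hρ (hx.comp_succAbove i)]
  · have h0 : onCliques G ρ (n + 1) (coboundary G n f) s = 0 := dif_neg h
    rw [h0]
    by_contra hne
    obtain ⟨hs, t, ht, hts⟩ := relDiff_ne_zero raisesDegree_simplicialDiff hne
    obtain ⟨y, hy⟩ := onCliques_ne_zero ht
    exact h (exists_lists hρ (by rw [hts, hy.card_eq]) hs.2)

theorem alternating_eq_zero_of_not_injective {n : ℕ} {f : CliqueTuple G n → ℝ}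
    (hf : ∀ (σ : Equiv.Perm (Fin n)) (x : CliqueTuple G n),
      f (x.comp σ) = ((Equiv.Perm.sign σ : ℤ) : ℝ) * f x)
    {x : CliqueTuple G n} (hx : ¬ Function.Injective x.1) : f x = 0 := by
  simp only [Function.Injective, not_forall] at hx
  obtain ⟨i, j, hij, hne⟩ := hx
  have h1 := hf (Equiv.swap i j) x
  have h2 : x.comp (Equiv.swap i j) = x := by
    apply Subtype.ext
    funext l
    change x.1 (Equiv.swap i j l) = x.1 l
    rcases eq_or_ne l i with rfl | hli
    · rw [Equiv.swap_apply_left, hij]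
    rcases eq_or_ne l j with rfl | hlj
    · rw [Equiv.swap_apply_right, hij]
    rw [Equiv.swap_apply_of_ne_of_ne hli hlj]
  rw [h2, Equiv.Perm.sign_swap hne] at h1
  push_cast at h1
  linarith

theorem onCliques_injOn_cochain (hρ : Function.Injective ρ) {k : ℕ}
    {f g : CliqueTuple G (k + 1) → ℝ} (hf : f ∈ Cochain G k) (hg : g ∈ Cochain G k)
    (h : onCliques G ρ (k + 1) f = onCliques G ρ (k + 1) g) : f = g := by
  funext x
  by_cases hx : Function.Injective x.1
  · have hl : (x.comp (Tuple.sort (ρ ∘ x.1))).Lists ρ (Finset.univ.map ⟨x.1, hx⟩) := by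
      refine ⟨(Tuple.monotone_sort (ρ ∘ x.1)).strictMono_of_injective ?_, ?_⟩
      · exact (hρ.comp hx).comp (Equiv.injective _)
      · change Set.range (x.1 ∘ _) = _
        rw [(Tuple.sort (ρ ∘ x.1)).surjective.range_comp]
        simp
    have h1 := congrFun h (Finset.univ.map ⟨x.1, hx⟩)
    rw [onCliques_apply hρ hl, onCliques_apply hρ hl, hf, hg] at h1
    refine mul_left_cancel₀ ?_ h1
    rcases Int.units_eq_one_or (Equiv.Perm.sign (Tuple.sort (ρ ∘ x.1))) with h | h <;> simp [h]
  · rw [alternating_eq_zero_of_not_injective hf hx, alternating_eq_zero_of_not_injective hg hx]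

/-- Every function on the cliques of size `k + 1` extends to an alternating cochain. -/
theorem exists_cochain_of_cochainsOn (hρ : Function.Injective ρ) {k : ℕ} {F : Finset V → ℝ}
    (hF : F ∈ cochainsOn Finset.card (cliqueFamily G) (k + 1)) :
    ∃ f ∈ Cochain G k, onCliques G ρ (k + 1) f = F := by
  classical
  let f : CliqueTuple G (k + 1) → ℝ := fun x => if Function.Injective x.1 then
    ((Equiv.Perm.sign (Tuple.sort (ρ ∘ x.1)) : ℤ) : ℝ) * F (Finset.univ.image x.1) else 0
  have hpos : ∀ x : CliqueTuple G (k + 1), Function.Injective x.1 →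
      f x = ((Equiv.Perm.sign (Tuple.sort (ρ ∘ x.1)) : ℤ) : ℝ) * F (Finset.univ.image x.1) :=
    fun x hx => if_pos hx
  have hneg : ∀ x : CliqueTuple G (k + 1), ¬ Function.Injective x.1 → f x = 0 :=
    fun x hx => if_neg hx
  refine ⟨f, ?_, ?_⟩
  · intro σ x
    have hinj : Function.Injective (x.comp σ).1 ↔ Function.Injective x.1 :=
      ⟨fun h => Function.Injective.of_comp_right (f := x.1) (g := σ) h σ.surjective,
        fun h => h.comp σ.injective⟩
    by_cases hx : Function.Injective x.1
    · rw [hpos _ (hinj.2 hx), hpos _ hx]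
      have himage : Finset.univ.image (x.comp σ).1 = Finset.univ.image x.1 := by
        apply Finset.coe_injective
        simp only [Finset.coe_image, Finset.coe_univ, Set.image_univ]
        exact σ.surjective.range_comp x.1
      have hsort : σ * Tuple.sort (ρ ∘ (x.comp σ).1) = Tuple.sort (ρ ∘ x.1) := by
        apply Equiv.ext
        intro i
        exact (hρ.comp hx) (congrFun (Tuple.comp_perm_comp_sort_eq_comp_sort
          (f := ρ ∘ x.1) (σ := σ)) i)
      rw [himage, ← hsort, Equiv.Perm.sign_mul, ← mul_assoc]
      congr 1
      rcases Int.units_eq_one_or (Equiv.Perm.sign σ) with h | h <;> simp [h]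
    · rw [hneg _ (mt hinj.1 hx), hneg _ hx, mul_zero]
  · funext s
    by_cases hs : s ∈ cliqueFamily G ∧ s.card = k + 1
    · obtain ⟨x, hx⟩ := exists_lists hρ hs.2 hs.1.2
      have hsort : Tuple.sort (ρ ∘ x.1) = 1 := Tuple.sort_eq_refl_iff_monotone.2 hx.1.monotone
      have himage : Finset.univ.image x.1 = s := by
        apply Finset.coe_injective
        rw [← hx.2]
        simp
      rw [onCliques_apply hρ hx, hpos _ hx.injective, hsort, himage]
      simp
    · have h1 : F s = 0 := by
        by_contra h
        exact hs (hF s h)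
      rw [h1]
      by_contra h
      exact hs (onCliques_mem_cochainsOn _ s h)

/-- Cohomology can be computed with functions on cliques. -/
theorem bettiNumber_eq_cohDim [DecidableEq V] (hρ : Function.Injective ρ) (k : ℕ) :
    bettiNumber G k = cohDim (simplicialDiff ρ) Finset.card (cliqueFamily G) (k + 1) := by
  refine finrank_quotient_eq_of_map (onCliques G ρ (k + 1)) ?_ ?_ ?_
  · rintro f ⟨-, hf⟩
    rw [SetLike.mem_coe, LinearMap.mem_ker] at hf
    refine ⟨onCliques_mem_cochainsOn f, ?_⟩
    rw [SetLike.mem_coe, LinearMap.mem_ker, onCliques_coboundary hρ, hf, map_zero]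
  · rintro f ⟨hf, -⟩
    cases k with
    | zero =>
      constructor
      · rintro ⟨g, hg, hgf⟩
        have hg0 : g = 0 := by
          funext s
          by_contra h
          obtain ⟨h1, h2⟩ := hg s h
          exact (Finset.card_pos.2 h1.1).ne' (Nat.succ_injective h2)
        rw [hg0, map_zero] at hgf
        refine (Submodule.mem_bot ℝ).2 (onCliques_injOn_cochain hρ hf (zero_mem _) ?_)
        rw [← hgf, map_zero]
      · intro h
        rw [(Submodule.mem_bot ℝ).1 h, map_zero]
        exact zero_mem _
    | succ k =>
      constructor
      · rintro ⟨g, hg, hgf⟩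
        rw [SetLike.mem_coe, mem_cochainsOn_succ] at hg
        obtain ⟨g, hg', rfl⟩ := exists_cochain_of_cochainsOn hρ hg
        rw [onCliques_coboundary hρ] at hgf
        exact ⟨g, hg', onCliques_injOn_cochain hρ (coboundary_mem_cochain G k g hg') hf hgf⟩
      · rintro ⟨g, hg, rfl⟩
        exact ⟨onCliques G ρ (k + 1) g, mem_cochainsOn_succ.2 (onCliques_mem_cochainsOn g),
          onCliques_coboundary hρ _ _⟩
  · rintro F ⟨hF, hF0⟩
    rw [SetLike.mem_coe, LinearMap.mem_ker] at hF0
    obtain ⟨f, hf, rfl⟩ := exists_cochain_of_cochainsOn hρ hF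
    refine ⟨f, ⟨hf, ?_⟩, by rw [sub_self]; exact zero_mem _⟩
    rw [SetLike.mem_coe, LinearMap.mem_ker]
    refine onCliques_injOn_cochain hρ (coboundary_mem_cochain G k f hf) (zero_mem _) ?_
    rw [← onCliques_coboundary hρ, hF0, map_zero]

end CliqueComplex

/-! ### Families of finite sets: images and acyclicity -/

section Families

variable {U : Type u} {ρ : U → ℕ}

theorem vertexSign_map {V : Type v} (e : V ↪ U) (v : V) (s : Finset V) :
    vertexSign ρ (e v) (s.map e) = vertexSign (ρ ∘ e) v s := by
  rw [vertexSign, vertexSign, Finset.filter_map, Finset.card_map]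
  rfl

theorem ordConnected_map {V : Type v} (e : V ↪ U) {S : Set (Finset V)} (hS : S.OrdConnected) :
    (Finset.map e '' S).OrdConnected := by
  refine ⟨?_⟩
  rintro _ ⟨s, hs, rfl⟩ _ ⟨t, ht, rfl⟩ r ⟨hsr, hrt⟩
  obtain ⟨r', -, rfl⟩ := Finset.subset_map_iff.1 hrt
  exact ⟨r', hS.out hs ht ⟨Finset.map_subset_map.1 hsr, Finset.map_subset_map.1 hrt⟩, rfl⟩

theorem extend_comp_val {S : Set (Finset U)} {f : Finset U → ℝ} (hf : ∀ s, f s ≠ 0 → s ∈ S) :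
    Function.extend (Subtype.val : S → Finset U) (f ∘ Subtype.val) 0 = f := by
  funext s
  by_cases hs : s ∈ S
  · exact Subtype.val_injective.extend_apply (f ∘ Subtype.val) 0 ⟨s, hs⟩
  · rw [Function.extend_apply', Pi.zero_apply]
    · by_contra h
      exact hs (hf s (Ne.symm h))
    · rintro ⟨t, rfl⟩
      exact hs t.2

theorem extend_val_ne_zero {S : Set (Finset U)} {f : S → ℝ} {s : Finset U}
    (h : Function.extend Subtype.val f 0 s ≠ 0) : ∃ hs : s ∈ S, f ⟨s, hs⟩ ≠ 0 := by
  by_cases hs : s ∈ S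
  · refine ⟨hs, ?_⟩
    rwa [← Subtype.val_injective.extend_apply f 0 ⟨s, hs⟩]
  · refine absurd (Function.extend_apply' _ _ _ ?_) h
    rintro ⟨t, rfl⟩
    exact hs t.2

variable [DecidableEq U]

/-- The differential does not lead from a family to sets without faces in that family. -/
theorem simplicialDiff_eq_zero_of_forall_not_subset {S T : Set (Finset U)}
    (h : ∀ s ∈ S, ∀ t ∈ T, ¬ t ⊆ s) (f : Finset U → ℝ) (hf : ∀ t, f t ≠ 0 → t ∈ T) :
    ∀ s ∈ S, simplicialDiff ρ f s = 0 := by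
  intro s hs
  rw [simplicialDiff_apply]
  refine Finset.sum_eq_zero fun v _ => ?_
  have : f (s.erase v) = 0 := by
    by_contra hne
    exact h s hs _ (hf _ hne) (Finset.erase_subset _ _)
  rw [this, mul_zero]

theorem cohDim_map {V : Type v} [DecidableEq V] (e : V ↪ U) (S : Set (Finset V)) (n : ℕ) :
    cohDim (simplicialDiff ρ) Finset.card (Finset.map e '' S) n =
      cohDim (simplicialDiff (ρ ∘ e)) Finset.card S n := by
  refine cohDim_image (Finset.map_injective e) rfl (fun s _ => Finset.card_map e) ?_ n
  intro f _ s _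
  rw [simplicialDiff_apply, simplicialDiff_apply, Finset.sum_map]
  refine Finset.sum_congr rfl fun v _ => ?_
  rw [vertexSign_map, Function.comp_apply, Finset.map_erase]

/-- A form of `cocyclesOn_le_coboundariesOn_of_apex` in which an apex only has to exist for every
configuration of the vertices of the other colours. -/
theorem cocyclesOn_le_coboundariesOn_of_exists_apex [Finite U] (hρ : Function.Injective ρ)
    {S : Set (Finset U)} (hS : S.OrdConnected) (c : U → Prop) [DecidablePred c]
    (hex : ∀ s ∈ S, ∃ v, c v ∧ ∀ t ∈ S,
      (t.filter fun u => ¬ c u) = (s.filter fun u => ¬ c u) → insert v t ∈ S ∧ t.erase v ∈ S)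
    (n : ℕ) :
    cocyclesOn (simplicialDiff ρ) Finset.card S n ≤
      coboundariesOn (simplicialDiff ρ) Finset.card S n := by
  rcases S.eq_empty_or_nonempty with rfl | ⟨s₀, hs₀⟩
  · rintro f ⟨hf, -⟩
    have : f = 0 := by
      funext s
      by_contra h
      exact (hf s h).1
    rw [this]
    exact zero_mem _
  obtain ⟨v₀, -⟩ := hex s₀ hs₀
  choose a hac ha using hex
  classical
  let A : Finset U → U := fun q =>
    if h : ∃ s ∈ S, (s.filter fun u => ¬ c u) = q then a h.choose h.choose_spec.1 else v₀
  have hA : ∀ t ∈ S, c (A (t.filter fun u => ¬ c u)) ∧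
      insert (A (t.filter fun u => ¬ c u)) t ∈ S ∧ t.erase (A (t.filter fun u => ¬ c u)) ∈ S := by
    intro t ht
    have h : ∃ s ∈ S, (s.filter fun u => ¬ c u) = t.filter fun u => ¬ c u := ⟨t, ht, rfl⟩
    have h1 : A (t.filter fun u => ¬ c u) = a h.choose h.choose_spec.1 := dif_pos h
    rw [h1]
    exact ⟨hac _ _, ha _ _ t ht h.choose_spec.2.symm⟩
  exact cocyclesOn_le_coboundariesOn_of_apex hρ hS c (fun s => A (s.filter fun u => ¬ c u))
    (fun s hs => (hA s hs).1) (fun s hs => (hA s hs).2.1) (fun s hs => (hA s hs).2.2)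
    (fun s t h => congrArg A h) n

/-- The relative cochain complex of a family `S`, on the functions on `S` itself. -/
def subtypeDiff (ρ : U → ℕ) (S : Set (Finset U)) : (S → ℝ) →ₗ[ℝ] (S → ℝ) where
  toFun f s := simplicialDiff ρ (Function.extend Subtype.val f 0) s.1
  map_add' f g := by
    funext s
    have h : Function.extend Subtype.val (f + g) (0 : Finset U → ℝ) =
        Function.extend Subtype.val f 0 + Function.extend Subtype.val g 0 := by
      rw [← Function.extend_add, add_zero]
    rw [h, map_add]
    rfl
  map_smul' c f := by
    funext s
    have h : Function.extend Subtype.val (c • f) (0 : Finset U → ℝ) =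
        c • Function.extend Subtype.val f 0 := by
      rw [← Function.extend_smul, smul_zero]
    rw [h, map_smul]
    rfl

theorem subtypeDiff_apply {S : Set (Finset U)} (f : S → ℝ) (s : S) :
    subtypeDiff ρ S f s = simplicialDiff ρ (Function.extend Subtype.val f 0) s.1 :=
  rfl

theorem cohDim_subtypeDiff (S : Set (Finset U)) (n : ℕ) :
    cohDim (simplicialDiff ρ) Finset.card S n =
      cohDim (subtypeDiff ρ S) (fun s => s.1.card) Set.univ n := by
  refine cohDim_image (e := Subtype.val) Subtype.val_injective ?_ (fun s _ => rfl) ?_ n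
  · rw [Set.image_univ, Subtype.range_coe]
  · intro f hf s _
    rw [subtypeDiff_apply, extend_comp_val hf]

theorem subtypeDiff_comp_self (hρ : Function.Injective ρ) {S : Set (Finset U)}
    (hS : S.OrdConnected) : subtypeDiff ρ S ∘ₗ subtypeDiff ρ S = 0 := by
  refine LinearMap.ext fun f => ?_
  funext s
  have h := isComplexOn_simplicialDiff hρ hS (Function.extend Subtype.val f 0)
    fun t ht => (extend_val_ne_zero ht).1
  have h1 : Function.extend Subtype.val (subtypeDiff ρ S f) 0 =
      relDiff (simplicialDiff ρ) S (Function.extend Subtype.val f 0) := by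
    rw [← extend_comp_val (S := S)
      (f := relDiff (simplicialDiff ρ) S (Function.extend Subtype.val f 0))]
    · congr 1
      funext t
      rw [Function.comp_apply, relDiff_apply_of_mem t.2, subtypeDiff_apply]
    · intro t ht
      by_contra hne
      exact ht (relDiff_apply_of_notMem hne _)
  rw [LinearMap.comp_apply, subtypeDiff_apply, h1, ← relDiff_apply_of_mem s.2, h]
  rfl

theorem toMatrix'_subtypeDiff_ne_zero {S : Set (Finset U)} [Fintype S] [DecidableEq S] (s t : S)
    (h : LinearMap.toMatrix' (subtypeDiff ρ S) s t ≠ 0) : s.1.card = t.1.card + 1 := by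
  rw [LinearMap.toMatrix'_apply, subtypeDiff_apply] at h
  obtain ⟨r, hr, hsr⟩ := raisesDegree_simplicialDiff _ _ h
  obtain ⟨hrS, hr⟩ := extend_val_ne_zero hr
  by_cases hrt : t = ⟨r, hrS⟩
  · rw [hrt, hsr]
  · exact absurd (Pi.single_eq_of_ne (Ne.symm hrt) 1) hr

end Families

/-! ### The cochains of a join -/

section Join

open Matrix
open scoped Kronecker

variable {V : Type u} {W : Type v}

theorem vertexSign_disjSum_inl {ρ : V ⊕ W → ℕ} (hlt : ∀ a b, ρ (.inl a) < ρ (.inr b)) (a : V)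
    (s : Finset V) (t : Finset W) :
    vertexSign ρ (.inl a) (s.disjSum t) = vertexSign (ρ ∘ .inl) a s := by
  have h : ((s.disjSum t).filter fun u => ρ u < ρ (.inl a)) =
      (s.filter fun u => ρ (.inl u) < ρ (.inl a)).map .inl := by
    ext (u | u)
    · simp
    · simp [(hlt a u).le]
  rw [vertexSign, vertexSign, h, Finset.card_map]
  rfl

theorem vertexSign_disjSum_inr {ρ : V ⊕ W → ℕ} (hlt : ∀ a b, ρ (.inl a) < ρ (.inr b)) (b : W)
    (s : Finset V) (t : Finset W) :
    vertexSign ρ (.inr b) (s.disjSum t) = (-1) ^ s.card * vertexSign (ρ ∘ .inr) b t := by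
  have h : ((s.disjSum t).filter fun u => ρ u < ρ (.inr b)) =
      s.disjSum (t.filter fun u => ρ (.inr u) < ρ (.inr b)) := by
    ext (u | u)
    · simp [hlt u b]
    · simp
  rw [vertexSign, vertexSign, h, Finset.card_disjSum, pow_add]
  rfl

/-- The join of two families of finite sets. -/
def joinFamily (A : Set (Finset V)) (B : Set (Finset W)) : Set (Finset (V ⊕ W)) :=
  {s | s.toLeft ∈ A ∧ s.toRight ∈ B}

variable [DecidableEq V] [DecidableEq W]

/-- The cochains of a join form the tensor product of the complexes of cochains. -/
theorem cohDim_joinFamily [Finite V] [Finite W] {ρ : V ⊕ W → ℕ} (hρ : Function.Injective ρ)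
    (hlt : ∀ a b, ρ (.inl a) < ρ (.inr b)) {A : Set (Finset V)} {B : Set (Finset W)}
    (hA : A.OrdConnected) (hB : B.OrdConnected) (n : ℕ) :
    cohDim (simplicialDiff ρ) Finset.card (joinFamily A B) n =
      ∑ ab ∈ Finset.HasAntidiagonal.antidiagonal n,
        cohDim (simplicialDiff (ρ ∘ .inl)) Finset.card A ab.1 *
          cohDim (simplicialDiff (ρ ∘ .inr)) Finset.card B ab.2 := by
  classical
  have := Fintype.ofFinite V
  have := Fintype.ofFinite W
  have := Fintype.ofFinite A
  have := Fintype.ofFinite B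
  let dA : Matrix A A ℝ := LinearMap.toMatrix' (subtypeDiff (ρ ∘ .inl) A)
  let dB : Matrix B B ℝ := LinearMap.toMatrix' (subtypeDiff (ρ ∘ .inr) B)
  have hdA : dA.mulVecLin = subtypeDiff (ρ ∘ .inl) A := toLin'_toMatrix' _
  have hdB : dB.mulVecLin = subtypeDiff (ρ ∘ .inr) B := toLin'_toMatrix' _
  have hA2 : dA * dA = 0 := by
    rw [← LinearMap.toMatrix'_comp, subtypeDiff_comp_self (hρ.comp Sum.inl_injective) hA, map_zero]
  have hB2 : dB * dB = 0 := by
    rw [← LinearMap.toMatrix'_comp, subtypeDiff_comp_self (hρ.comp Sum.inr_injective) hB, map_zero]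
  have key := cohDim_tensorDiff hA2 toMatrix'_subtypeDiff_ne_zero hB2
    toMatrix'_subtypeDiff_ne_zero n
  simp only [hdA, hdB, ← cohDim_subtypeDiff] at key
  rw [← key]
  refine cohDim_image (e := fun x : A × B => x.1.1.disjSum x.2.1) ?_ ?_ ?_ ?_ n
  · rintro ⟨s, t⟩ ⟨s', t'⟩ h
    have h1 := congrArg Finset.toLeft h
    have h2 := congrArg Finset.toRight h
    simp only [Finset.toLeft_disjSum, Finset.toRight_disjSum] at h1 h2
    rw [Subtype.ext h1, Subtype.ext h2]
  · ext s
    constructor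
    · rintro ⟨h1, h2⟩
      exact ⟨(⟨_, h1⟩, ⟨_, h2⟩), trivial, Finset.toLeft_disjSum_toRight⟩
    · rintro ⟨⟨x, y⟩, -, rfl⟩
      refine ⟨?_, ?_⟩
      · rw [Finset.toLeft_disjSum]
        exact x.2
      · rw [Finset.toRight_disjSum]
        exact y.2
  · rintro ⟨s, t⟩ -
    exact Finset.card_disjSum _ _
  · rintro f hf ⟨s, t⟩ -
    have hf' : ∀ x y, f (x.disjSum y) ≠ 0 → x ∈ A ∧ y ∈ B := by
      intro x y hxy
      obtain ⟨h1, h2⟩ := hf _ hxy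
      rw [Finset.toLeft_disjSum] at h1
      rw [Finset.toRight_disjSum] at h2
      exact ⟨h1, h2⟩
    have hL : ∑ s' : A, dA s s' * f (s'.1.disjSum t.1) =
        ∑ a ∈ s.1, vertexSign (ρ ∘ .inl) a s.1 * f ((s.1.erase a).disjSum t.1) := by
      have h1 := congrFun (LinearMap.congr_fun hdA
        ((fun x : Finset V => f (x.disjSum t.1)) ∘ Subtype.val)) s
      rw [subtypeDiff_apply, extend_comp_val fun x hx => (hf' x t.1 hx).1] at h1
      exact h1
    have hR : ∑ t' : B, dB t t' * f (s.1.disjSum t'.1) =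
        ∑ b ∈ t.1, vertexSign (ρ ∘ .inr) b t.1 * f (s.1.disjSum (t.1.erase b)) := by
      have h1 := congrFun (LinearMap.congr_fun hdB
        ((fun y : Finset W => f (s.1.disjSum y)) ∘ Subtype.val)) t
      rw [subtypeDiff_apply, extend_comp_val fun y hy => (hf' s.1 y hy).2] at h1
      exact h1
    have hel : ∀ a, (s.1.disjSum t.1).erase (.inl a) = (s.1.erase a).disjSum t.1 := by
      intro a
      ext (u | u) <;> simp
    have her : ∀ b, (s.1.disjSum t.1).erase (.inr b) = s.1.disjSum (t.1.erase b) := by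
      intro b
      ext (u | u) <;> simp
    have hlhs : simplicialDiff ρ f (s.1.disjSum t.1) =
        ∑ s' : A, dA s s' * f (s'.1.disjSum t.1) +
          (-1) ^ s.1.card * ∑ t' : B, dB t t' * f (s.1.disjSum t'.1) := by
      rw [simplicialDiff_apply, Finset.sum_disjSum, hL, hR, Finset.mul_sum]
      congr 1
      · refine Finset.sum_congr rfl fun a _ => ?_
        rw [vertexSign_disjSum_inl hlt, hel]
      · refine Finset.sum_congr rfl fun b _ => ?_
        rw [vertexSign_disjSum_inr hlt, her, mul_assoc]
    refine hlhs.trans ?_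
    rw [mulVecLin_apply, tensorDiff, add_mulVec, Pi.add_apply]
    simp only [mulVec, dotProduct, kronecker_apply, signMatrix, Fintype.sum_prod_type,
      Function.comp_apply]
    congr 1
    · refine Finset.sum_congr rfl fun s' _ => ?_
      rw [Finset.sum_eq_single t]
      · rw [one_apply_eq, mul_one]
      · intro t' _ hne
        rw [one_apply_ne hne.symm, mul_zero, zero_mul]
      · exact fun h => absurd (Finset.mem_univ t) h
    · rw [Finset.sum_eq_single s]
      · rw [diagonal_apply_eq, Finset.mul_sum]
        simp only [mul_assoc]
      · intro s' _ hne
        refine Finset.sum_eq_zero fun t' _ => ?_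
        rw [diagonal_apply_ne _ hne.symm, zero_mul, zero_mul]
      · exact fun h => absurd (Finset.mem_univ s) h

end Join

/-! ### Betti numbers of isomorphic graphs, disjoint unions and the point -/

section Basic

variable {V : Type u} {W : Type v} {G : SimpleGraph V} {H : SimpleGraph W}

theorem exists_rank (U : Type w) [Finite U] :
    ∃ (ρ : U → ℕ) (N : ℕ), Function.Injective ρ ∧ ∀ u, ρ u < N := by
  obtain ⟨N, ⟨e⟩⟩ := Finite.exists_equiv_fin U
  exact ⟨fun u => e u, N, Fin.val_injective.comp e.injective, fun u => (e u).2⟩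

theorem cohDim_cliqueFamily_zero [DecidableEq V] (ρ : V → ℕ) :
    cohDim (simplicialDiff ρ) Finset.card (cliqueFamily G) 0 = 0 := by
  have h : ∀ f : cocyclesOn (simplicialDiff ρ) Finset.card (cliqueFamily G) 0, f = 0 := by
    rintro ⟨f, hf, -⟩
    apply Subtype.ext
    funext s
    by_contra hne
    obtain ⟨h1, h2⟩ := hf s hne
    exact h1.1.ne_empty (Finset.card_eq_zero.1 h2)
  have : Subsingleton (cocyclesOn (simplicialDiff ρ) Finset.card (cliqueFamily G) 0) :=
    ⟨fun a b => (h a).trans (h b).symm⟩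
  exact Module.finrank_zero_of_subsingleton

/-- The Betti numbers of a graph on a subset of the vertices of `U` as the cohomology of a family of
finite subsets of `U`. -/
theorem bettiNumber_eq_cohDim_map {U : Type w} [DecidableEq U] {ρ : U → ℕ}
    (hρ : Function.Injective ρ) (e : V ↪ U) (k : ℕ) :
    bettiNumber G k =
      cohDim (simplicialDiff ρ) Finset.card (Finset.map e '' cliqueFamily G) (k + 1) := by
  classical
  rw [cohDim_map, ← bettiNumber_eq_cohDim (hρ.comp e.injective)]

theorem bettiNumber_congr [Finite W] (e : G ≃g H) (k : ℕ) : bettiNumber G k = bettiNumber H k := by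
  classical
  obtain ⟨ρ, -, hρ, -⟩ := exists_rank W
  rw [bettiNumber_eq_cohDim_map hρ e.toEquiv.toEmbedding, bettiNumber_eq_cohDim hρ]
  congr 1
  ext s
  constructor
  · rintro ⟨t, ⟨ht, hG⟩, rfl⟩
    refine ⟨ht.map, ?_⟩
    rw [Finset.coe_map]
    rintro _ ⟨a, ha, rfl⟩ _ ⟨b, hb, rfl⟩ hab
    exact e.map_rel_iff.2 (hG ha hb fun h => hab (by rw [h]))
  · rintro ⟨hs, hH⟩
    refine ⟨s.map e.symm.toEquiv.toEmbedding, ⟨hs.map, ?_⟩, ?_⟩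
    · rw [Finset.coe_map]
      rintro _ ⟨a, ha, rfl⟩ _ ⟨b, hb, rfl⟩ hab
      exact e.symm.map_rel_iff.2 (hH ha hb fun h => hab (by rw [h]))
    · rw [Finset.map_map]
      convert Finset.map_refl
      ext a
      exact e.apply_symm_apply a

theorem poincarePolynomial_congr [Finite V] [Finite W] (e : G ≃g H) :
    poincarePolynomial G = poincarePolynomial H := by
  ext k
  rw [coeff_poincarePolynomial, coeff_poincarePolynomial, bettiNumber_congr e]

theorem cliqueFamily_sum :
    cliqueFamily (G.sum H) =
      Finset.map .inl '' cliqueFamily G ∪ Finset.map .inr '' cliqueFamily H := by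
  classical
  ext s
  constructor
  · rintro ⟨⟨u, hu⟩, hs⟩
    rcases u with a | b
    · refine Or.inl ⟨s.toLeft, ⟨⟨a, Finset.mem_toLeft.2 hu⟩, ?_⟩, ?_⟩
      · intro x hx y hy hxy
        exact hs (Finset.mem_toLeft.1 hx) (Finset.mem_toLeft.1 hy) (Sum.inl_injective.ne hxy)
      · ext (x | y)
        · simp
        · have : Sum.inr y ∉ s := fun hy => by
            simpa using hs hu hy Sum.inl_ne_inr
          simpa using this
    · refine Or.inr ⟨s.toRight, ⟨⟨b, Finset.mem_toRight.2 hu⟩, ?_⟩, ?_⟩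
      · intro x hx y hy hxy
        exact hs (Finset.mem_toRight.1 hx) (Finset.mem_toRight.1 hy) (Sum.inr_injective.ne hxy)
      · ext (x | y)
        · have : Sum.inl x ∉ s := fun hx => by
            simpa using hs hu hx Sum.inr_ne_inl
          simpa using this
        · simp
  · rintro (⟨t, ⟨ht, hG⟩, rfl⟩ | ⟨t, ⟨ht, hG⟩, rfl⟩)
    · refine ⟨ht.map, ?_⟩
      rw [Finset.coe_map]
      rintro _ ⟨a, ha, rfl⟩ _ ⟨b, hb, rfl⟩ hab
      exact hG ha hb fun h => hab (by rw [h])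
    · refine ⟨ht.map, ?_⟩
      rw [Finset.coe_map]
      rintro _ ⟨a, ha, rfl⟩ _ ⟨b, hb, rfl⟩ hab
      exact hG ha hb fun h => hab (by rw [h])

theorem bettiNumber_sum [Finite V] [Finite W] (k : ℕ) :
    bettiNumber (G.sum H) k = bettiNumber G k + bettiNumber H k := by
  classical
  obtain ⟨ρ, -, hρ, -⟩ := exists_rank (V ⊕ W)
  have hlr : ∀ s ∈ Finset.map .inl '' cliqueFamily G,
      ∀ t ∈ Finset.map (.inr : W ↪ V ⊕ W) '' cliqueFamily H, ¬ t ⊆ s := by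
    rintro _ ⟨s, -, rfl⟩ _ ⟨t, ⟨⟨b, hb⟩, -⟩, rfl⟩ hst
    obtain ⟨a, -, ha⟩ := Finset.mem_map.1 (hst (Finset.mem_map_of_mem _ hb))
    exact Sum.inl_ne_inr ha
  have hrl : ∀ s ∈ Finset.map .inr '' cliqueFamily H,
      ∀ t ∈ Finset.map (.inl : V ↪ V ⊕ W) '' cliqueFamily G, ¬ t ⊆ s := by
    rintro _ ⟨s, -, rfl⟩ _ ⟨t, ⟨⟨b, hb⟩, -⟩, rfl⟩ hst
    obtain ⟨a, -, ha⟩ := Finset.mem_map.1 (hst (Finset.mem_map_of_mem _ hb))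
    exact Sum.inr_ne_inl ha
  rw [bettiNumber_eq_cohDim hρ, cliqueFamily_sum, cohDim_union raisesDegree_simplicialDiff
    (Set.disjoint_left.2 fun s hs hs' => hlr s hs s hs' subset_rfl)
    (simplicialDiff_eq_zero_of_forall_not_subset hlr)
    (simplicialDiff_eq_zero_of_forall_not_subset hrl)
    (isComplexOn_simplicialDiff hρ (ordConnected_map _ ordConnected_cliqueFamily))
    (isComplexOn_simplicialDiff hρ (ordConnected_map _ ordConnected_cliqueFamily))
    (cliqueFamily_sum (G := G) (H := H) ▸
      isComplexOn_simplicialDiff hρ ordConnected_cliqueFamily),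
    ← bettiNumber_eq_cohDim_map hρ, ← bettiNumber_eq_cohDim_map hρ]

theorem bettiNumber_zero_of_unique [Unique V] : bettiNumber G 0 = 1 := by
  have hx : ∀ x y : CliqueTuple G 1, x = y := fun x y =>
    Subtype.ext (funext fun _ => Subsingleton.elim _ _)
  have hcoc : cocycles G 0 = ⊤ := by
    rw [eq_top_iff]
    rintro f -
    refine ⟨fun σ x => ?_, ?_⟩
    · obtain rfl : σ = 1 := Equiv.ext fun i => Subsingleton.elim (α := Fin 1) _ _
      rw [hx (x.comp _) x]
      simp
    · funext x
      change coboundary G 1 f x = 0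
      rw [coboundary_apply, Fin.sum_univ_two,
        hx (x.comp (Fin.succAbove 0)) (x.comp (Fin.succAbove 1))]
      simp
  let x₀ : CliqueTuple G 1 := ⟨fun _ => default, by
    rintro _ ⟨i, rfl⟩ _ ⟨j, rfl⟩ h
    exact absurd rfl h⟩
  have : Unique (CliqueTuple G 1) := ⟨⟨x₀⟩, fun x => hx x x₀⟩
  have hbot : (coboundaries G 0).submoduleOf (cocycles G 0) = ⊥ := by
    rw [coboundaries, Submodule.submoduleOf, Submodule.comap_bot, Submodule.ker_subtype]
  rw [bettiNumber, (Submodule.quotEquivOfEqBot _ hbot).finrank_eq, hcoc, finrank_top,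
    Module.finrank_pi]
  exact Fintype.card_unique

end Basic

/-! ### The strong product -/

section StrongProduct

variable {V : Type u} {W : Type v} (G : SimpleGraph V) (H : SimpleGraph W)

/-- The vertices of the first factor that occur in `s`, on their own or in a pair. -/
def fstShadow (s : Finset ((V × W) ⊕ (V ⊕ W))) : Set V :=
  {a | (∃ b, .inl (a, b) ∈ s) ∨ .inr (.inl a) ∈ s}

/-- The vertices of the second factor that occur in `s`, on their own or in a pair. -/
def sndShadow (s : Finset ((V × W) ⊕ (V ⊕ W))) : Set W :=
  {b | (∃ a, .inl (a, b) ∈ s) ∨ .inr (.inr b) ∈ s}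

/-- The finite sets of pairs, vertices of the first factor and vertices of the second factor, all of
whose components in either factor span a complete subgraph. -/
def IsJointClique (s : Finset ((V × W) ⊕ (V ⊕ W))) : Prop :=
  G.IsClique (fstShadow s) ∧ H.IsClique (sndShadow s)

/-- Some element of `s` is a pair. -/
def HasPair (s : Finset ((V × W) ⊕ (V ⊕ W))) : Prop := ∃ p, .inl p ∈ s

/-- Some element of `s` is a vertex of the first factor. -/
def HasFst (s : Finset ((V × W) ⊕ (V ⊕ W))) : Prop := ∃ a, .inr (.inl a) ∈ s

/-- Some element of `s` is a vertex of the second factor. -/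
def HasSnd (s : Finset ((V × W) ⊕ (V ⊕ W))) : Prop := ∃ b, .inr (.inr b) ∈ s

variable {G H}

theorem fstShadow_mono {s t : Finset ((V × W) ⊕ (V ⊕ W))} (h : s ⊆ t) :
    fstShadow s ⊆ fstShadow t :=
  fun _ ha => ha.imp (fun ⟨b, hb⟩ => ⟨b, h hb⟩) fun ha => h ha

theorem sndShadow_mono {s t : Finset ((V × W) ⊕ (V ⊕ W))} (h : s ⊆ t) :
    sndShadow s ⊆ sndShadow t :=
  fun _ hb => hb.imp (fun ⟨a, ha⟩ => ⟨a, h ha⟩) fun hb => h hb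

theorem IsJointClique.mono {s t : Finset ((V × W) ⊕ (V ⊕ W))} (h : s ⊆ t)
    (ht : IsJointClique G H t) : IsJointClique G H s :=
  ⟨ht.1.subset (fstShadow_mono h), ht.2.subset (sndShadow_mono h)⟩

theorem HasPair.mono {s t : Finset ((V × W) ⊕ (V ⊕ W))} (h : s ⊆ t) : HasPair s → HasPair t :=
  fun ⟨p, hp⟩ => ⟨p, h hp⟩

theorem HasFst.mono {s t : Finset ((V × W) ⊕ (V ⊕ W))} (h : s ⊆ t) : HasFst s → HasFst t :=
  fun ⟨p, hp⟩ => ⟨p, h hp⟩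

theorem HasSnd.mono {s t : Finset ((V × W) ⊕ (V ⊕ W))} (h : s ⊆ t) : HasSnd s → HasSnd t :=
  fun ⟨p, hp⟩ => ⟨p, h hp⟩

variable (G H)

/-- Joint cliques that contain a pair but no vertex of the second factor. -/
def pairNoSnd : Set (Finset ((V × W) ⊕ (V ⊕ W))) :=
  {s | IsJointClique G H s ∧ HasPair s ∧ ¬ HasSnd s}

/-- Joint cliques that contain a pair and a vertex of the first factor. -/
def pairFst : Set (Finset ((V × W) ⊕ (V ⊕ W))) :=
  {s | IsJointClique G H s ∧ HasPair s ∧ HasFst s}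

/-- Joint cliques that contain a vertex of each of the two factors. -/
def fstSnd : Set (Finset ((V × W) ⊕ (V ⊕ W))) :=
  {s | IsJointClique G H s ∧ HasFst s ∧ HasSnd s}

variable {G H}

theorem ordConnected_pairNoSnd : (pairNoSnd G H).OrdConnected :=
  ⟨fun _ hs _ ht _ hr => ⟨ht.1.mono hr.2, hs.2.1.mono hr.1, fun h => ht.2.2 (h.mono hr.2)⟩⟩

theorem ordConnected_pairFst : (pairFst G H).OrdConnected :=
  ⟨fun _ hs _ ht _ hr => ⟨ht.1.mono hr.2, hs.2.1.mono hr.1, hs.2.2.mono hr.1⟩⟩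

theorem ordConnected_fstSnd : (fstSnd G H).OrdConnected :=
  ⟨fun _ hs _ ht _ hr => ⟨ht.1.mono hr.2, hs.2.1.mono hr.1, hs.2.2.mono hr.1⟩⟩

section Acyclic

variable [Finite V] [Finite W] [DecidableEq V] [DecidableEq W] {ρ : (V × W) ⊕ (V ⊕ W) → ℕ}

theorem mem_iff_of_filter_eq {U : Type w} [DecidableEq U] {c : U → Prop} [DecidablePred c]
    {s t : Finset U} (h : (t.filter fun u => ¬ c u) = s.filter fun u => ¬ c u) {u : U}
    (hu : ¬ c u) : u ∈ t ↔ u ∈ s := by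
  have := Finset.ext_iff.1 h u
  simpa [hu] using this

/-- The first component of a pair in a joint clique is a cone point for the vertices of the first
factor. -/
theorem acyclic_pairNoSnd (hρ : Function.Injective ρ) (n : ℕ) :
    cocyclesOn (simplicialDiff ρ) Finset.card (pairNoSnd G H) n ≤
      coboundariesOn (simplicialDiff ρ) Finset.card (pairNoSnd G H) n := by
  classical
  refine cocyclesOn_le_coboundariesOn_of_exists_apex hρ ordConnected_pairNoSnd
    (fun u => ∃ a, u = .inr (.inl a)) ?_ n
  rintro s ⟨-, ⟨⟨a, b⟩, hp⟩, -⟩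
  refine ⟨.inr (.inl a), ⟨a, rfl⟩, ?_⟩
  rintro t ⟨ht, htZ, htY⟩ hst
  have hpt : .inl (a, b) ∈ t := (mem_iff_of_filter_eq hst (by simp)).2 hp
  refine ⟨⟨⟨ht.1.subset ?_, ht.2.subset ?_⟩, htZ.mono (Finset.subset_insert _ _), ?_⟩,
    ⟨ht.mono (Finset.erase_subset _ _), ⟨_, Finset.mem_erase.2 ⟨by simp, hpt⟩⟩,
      fun h => htY (h.mono (Finset.erase_subset _ _))⟩⟩
  · rintro c (⟨d, hd⟩ | hc)
    · exact Or.inl ⟨d, by simpa using hd⟩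
    · rcases Finset.mem_insert.1 hc with h | h
      · obtain rfl : c = a := by simpa using h
        exact Or.inl ⟨b, hpt⟩
      · exact Or.inr h
  · rintro d (⟨c, hc⟩ | hd)
    · exact Or.inl ⟨c, by simpa using hc⟩
    · exact Or.inr (by simpa using hd)
  · rintro ⟨d, hd⟩
    exact htY ⟨d, by simpa using hd⟩

/-- The second component of a pair in a joint clique is a cone point for the vertices of the second
factor. -/
theorem acyclic_pairFst (hρ : Function.Injective ρ) (n : ℕ) :
    cocyclesOn (simplicialDiff ρ) Finset.card (pairFst G H) n ≤
      coboundariesOn (simplicialDiff ρ) Finset.card (pairFst G H) n := by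
  classical
  refine cocyclesOn_le_coboundariesOn_of_exists_apex hρ ordConnected_pairFst
    (fun u => ∃ b, u = .inr (.inr b)) ?_ n
  rintro s ⟨-, ⟨⟨a, b⟩, hp⟩, -⟩
  refine ⟨.inr (.inr b), ⟨b, rfl⟩, ?_⟩
  rintro t ⟨ht, htZ, ⟨x, hx⟩⟩ hst
  have hpt : .inl (a, b) ∈ t := (mem_iff_of_filter_eq hst (by simp)).2 hp
  refine ⟨⟨⟨ht.1.subset ?_, ht.2.subset ?_⟩, htZ.mono (Finset.subset_insert _ _),
    ⟨x, Finset.mem_insert_of_mem hx⟩⟩,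
    ⟨ht.mono (Finset.erase_subset _ _), ⟨_, Finset.mem_erase.2 ⟨by simp, hpt⟩⟩,
      ⟨x, Finset.mem_erase.2 ⟨by simp, hx⟩⟩⟩⟩
  · rintro c (⟨d, hd⟩ | hc)
    · exact Or.inl ⟨d, by simpa using hd⟩
    · exact Or.inr (by simpa using hc)
  · rintro d (⟨c, hc⟩ | hd)
    · exact Or.inl ⟨c, by simpa using hc⟩
    · rcases Finset.mem_insert.1 hd with h | h
      · obtain rfl : d = b := by simpa using h
        exact Or.inl ⟨a, hpt⟩
      · exact Or.inr h

/-- A pair of vertices of the two factors in a joint clique is a cone point for the pairs. -/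
theorem acyclic_fstSnd (hρ : Function.Injective ρ) (n : ℕ) :
    cocyclesOn (simplicialDiff ρ) Finset.card (fstSnd G H) n ≤
      coboundariesOn (simplicialDiff ρ) Finset.card (fstSnd G H) n := by
  classical
  refine cocyclesOn_le_coboundariesOn_of_exists_apex hρ ordConnected_fstSnd
    (fun u => ∃ p, u = .inl p) ?_ n
  rintro s ⟨-, ⟨a, ha⟩, ⟨b, hb⟩⟩
  refine ⟨.inl (a, b), ⟨(a, b), rfl⟩, ?_⟩
  rintro t ⟨ht, -, -⟩ hst
  have hat : .inr (.inl a) ∈ t := (mem_iff_of_filter_eq hst (by simp)).2 ha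
  have hbt : .inr (.inr b) ∈ t := (mem_iff_of_filter_eq hst (by simp)).2 hb
  refine ⟨⟨⟨ht.1.subset ?_, ht.2.subset ?_⟩, ⟨a, Finset.mem_insert_of_mem hat⟩,
      ⟨b, Finset.mem_insert_of_mem hbt⟩⟩,
    ⟨ht.mono (Finset.erase_subset _ _), ⟨a, Finset.mem_erase.2 ⟨by simp, hat⟩⟩,
      ⟨b, Finset.mem_erase.2 ⟨by simp, hbt⟩⟩⟩⟩
  · rintro c (⟨d, hd⟩ | hc)
    · rcases Finset.mem_insert.1 hd with h | h
      · obtain ⟨rfl, -⟩ : c = a ∧ d = b := by simpa using h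
        exact Or.inr hat
      · exact Or.inl ⟨d, h⟩
    · exact Or.inr (by simpa using hc)
  · rintro d (⟨c, hc⟩ | hd)
    · rcases Finset.mem_insert.1 hc with h | h
      · obtain ⟨-, rfl⟩ : c = a ∧ d = b := by simpa using h
        exact Or.inr hbt
      · exact Or.inl ⟨c, h⟩
    · exact Or.inr (by simpa using hd)

end Acyclic

theorem isClique_strongProd {t : Set (V × W)} :
    (strongProd G H).IsClique t ↔ G.IsClique (Prod.fst '' t) ∧ H.IsClique (Prod.snd '' t) := by
  constructor
  · intro h
    constructor
    · rintro _ ⟨x, hx, rfl⟩ _ ⟨y, hy, rfl⟩ hxy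
      have := h hx hy fun e => hxy (congrArg Prod.fst e)
      rw [strongProd_adj] at this
      tauto
    · rintro _ ⟨x, hx, rfl⟩ _ ⟨y, hy, rfl⟩ hxy
      have := h hx hy fun e => hxy (congrArg Prod.snd e)
      rw [strongProd_adj] at this
      tauto
  · rintro ⟨hG, hH⟩ x hx y hy hxy
    rw [strongProd_adj]
    have h1 := hG (Set.mem_image_of_mem _ hx) (Set.mem_image_of_mem _ hy)
    have h2 := hH (Set.mem_image_of_mem _ hx) (Set.mem_image_of_mem _ hy)
    by_cases e1 : x.1 = y.1
    · have e2 : x.2 ≠ y.2 := fun e2 => hxy (Prod.ext e1 e2)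
      exact Or.inl (Or.inr ⟨h2 e2, e1⟩)
    · by_cases e2 : x.2 = y.2
      · exact Or.inl (Or.inl ⟨h1 e1, e2⟩)
      · exact Or.inr ⟨h1 e1, h2 e2⟩

theorem image_cliqueFamily_strongProd :
    Finset.map .inl '' cliqueFamily (strongProd G H) =
      {s | IsJointClique G H s ∧ HasPair s ∧ ¬ HasFst s ∧ ¬ HasSnd s} := by
  classical
  have h1 : ∀ t : Finset (V × W), fstShadow (t.map (.inl : _ ↪ (V × W) ⊕ (V ⊕ W))) =
      Prod.fst '' (t : Set (V × W)) := by
    intro t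
    ext a
    simp [fstShadow]
  have h2 : ∀ t : Finset (V × W), sndShadow (t.map (.inl : _ ↪ (V × W) ⊕ (V ⊕ W))) =
      Prod.snd '' (t : Set (V × W)) := by
    intro t
    ext a
    simp [sndShadow]
  ext s
  constructor
  · rintro ⟨t, ⟨⟨p, hp⟩, ht⟩, rfl⟩
    rw [isClique_strongProd, ← h1, ← h2] at ht
    exact ⟨ht, ⟨p, Finset.mem_map_of_mem _ hp⟩, by rintro ⟨a, ha⟩; simp at ha,
      by rintro ⟨b, hb⟩; simp at hb⟩
  · rintro ⟨hs, ⟨p, hp⟩, hX, hY⟩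
    have hst : s.toLeft.map .inl = s := by
      ext (x | a | b)
      · simp
      · have : .inr (.inl a) ∉ s := fun h => hX ⟨a, h⟩
        simpa using this
      · have : .inr (.inr b) ∉ s := fun h => hY ⟨b, h⟩
        simpa using this
    refine ⟨s.toLeft, ⟨⟨p, Finset.mem_toLeft.2 hp⟩, ?_⟩, hst⟩
    rw [isClique_strongProd, ← h1, ← h2, hst]
    exact hs

theorem image_joinFamily :
    Finset.map .inr '' joinFamily (cliqueFamily G) (cliqueFamily H) =
      {s : Finset ((V × W) ⊕ (V ⊕ W)) |
        IsJointClique G H s ∧ ¬ HasPair s ∧ HasFst s ∧ HasSnd s} := by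
  classical
  have h1 : ∀ t : Finset (V ⊕ W), fstShadow (t.map (.inr : _ ↪ (V × W) ⊕ (V ⊕ W))) =
      (t.toLeft : Set V) := by
    intro t
    ext a
    simp [fstShadow]
  have h2 : ∀ t : Finset (V ⊕ W), sndShadow (t.map (.inr : _ ↪ (V × W) ⊕ (V ⊕ W))) =
      (t.toRight : Set W) := by
    intro t
    ext a
    simp [sndShadow]
  ext s
  constructor
  · rintro ⟨t, ⟨⟨⟨a, ha⟩, hG⟩, ⟨⟨b, hb⟩, hH⟩⟩, rfl⟩
    rw [← h1] at hG
    rw [← h2] at hH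
    exact ⟨⟨hG, hH⟩, by rintro ⟨p, hp⟩; simp at hp,
      ⟨a, Finset.mem_map_of_mem _ (Finset.mem_toLeft.1 ha)⟩,
      ⟨b, Finset.mem_map_of_mem _ (Finset.mem_toRight.1 hb)⟩⟩
  · rintro ⟨hs, hZ, ⟨a, ha⟩, ⟨b, hb⟩⟩
    have hst : s.toRight.map .inr = s := by
      ext (p | x)
      · have : .inl p ∉ s := fun h => hZ ⟨p, h⟩
        simpa using this
      · simp
    refine ⟨s.toRight, ⟨⟨⟨a, by simpa using ha⟩, ?_⟩, ⟨⟨b, by simpa using hb⟩, ?_⟩⟩, hst⟩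
    · rw [← h1, hst]
      exact hs.1
    · rw [← h2, hst]
      exact hs.2

/-- The strong product has the cohomology of the relative cochains of the join of the factors, with
a shift of degrees. -/
theorem cohDim_strongProd_eq_join [Finite V] [Finite W] [DecidableEq V] [DecidableEq W]
    {ρ : (V × W) ⊕ (V ⊕ W) → ℕ} (hρ : Function.Injective ρ) (n : ℕ) :
    cohDim (simplicialDiff ρ) Finset.card
        (Finset.map .inl '' cliqueFamily (strongProd G H)) n =
      cohDim (simplicialDiff ρ) Finset.card
        (Finset.map .inr '' joinFamily (cliqueFamily G) (cliqueFamily H)) (n + 1) := by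
  rw [image_cliqueFamily_strongProd, image_joinFamily]
  let T₁ : Set (Finset ((V × W) ⊕ (V ⊕ W))) :=
    {s | IsJointClique G H s ∧ HasPair s ∧ HasFst s ∧ ¬ HasSnd s}
  let T₂ : Set (Finset ((V × W) ⊕ (V ⊕ W))) :=
    {s | IsJointClique G H s ∧ HasPair s ∧ HasFst s ∧ HasSnd s}
  have e₁ : {s | IsJointClique G H s ∧ HasPair s ∧ ¬ HasFst s ∧ ¬ HasSnd s} ∪ T₁ =
      pairNoSnd G H := by
    ext s
    simp only [T₁, pairNoSnd, Set.mem_union, Set.mem_ofPred_eq]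
    tauto
  have e₂ : T₁ ∪ T₂ = pairFst G H := by
    ext s
    simp only [T₁, T₂, pairFst, Set.mem_union, Set.mem_ofPred_eq]
    tauto
  have e₃ : {s | IsJointClique G H s ∧ ¬ HasPair s ∧ HasFst s ∧ HasSnd s} ∪ T₂ = fstSnd G H := by
    ext s
    simp only [T₂, fstSnd, Set.mem_union, Set.mem_ofPred_eq]
    tauto
  have h₁ := cohDim_eq_cohDim_succ (n := n) raisesDegree_simplicialDiff
    (Set.disjoint_left.2 fun s hs hs' => hs.2.2.1 hs'.2.2.1)
    (simplicialDiff_eq_zero_of_forall_not_subset fun s hs t ht hts =>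
      hs.2.2.1 (ht.2.2.1.mono hts))
    (e₁ ▸ isComplexOn_simplicialDiff hρ ordConnected_pairNoSnd)
    (e₁ ▸ acyclic_pairNoSnd hρ)
  have h₂ := cohDim_eq_cohDim_succ (n := n + 1) raisesDegree_simplicialDiff
    (Set.disjoint_left.2 fun s hs hs' => hs.2.2.2 hs'.2.2.2)
    (simplicialDiff_eq_zero_of_forall_not_subset fun s hs t ht hts =>
      hs.2.2.2 (ht.2.2.2.mono hts))
    (e₂ ▸ isComplexOn_simplicialDiff hρ ordConnected_pairFst)
    (e₂ ▸ acyclic_pairFst hρ)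
  have h₃ := cohDim_eq_cohDim_succ (n := n + 1) raisesDegree_simplicialDiff
    (Set.disjoint_left.2 fun s hs hs' => hs.2.1 hs'.2.1)
    (simplicialDiff_eq_zero_of_forall_not_subset fun s hs t ht hts =>
      hs.2.1 (ht.2.1.mono hts))
    (e₃ ▸ isComplexOn_simplicialDiff hρ ordConnected_fstSnd)
    (e₃ ▸ acyclic_fstSnd hρ)
  rw [h₁, h₂, h₃]

/-- The Künneth formula for the strong product. -/
theorem bettiNumber_strongProd [Finite V] [Finite W] (k : ℕ) :
    bettiNumber (strongProd G H) k = ∑ ij ∈ Finset.HasAntidiagonal.antidiagonal k,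
      bettiNumber G ij.1 * bettiNumber H ij.2 := by
  classical
  obtain ⟨ρV, N, hV, hVN⟩ := exists_rank V
  obtain ⟨ρW, M, hW, hWM⟩ := exists_rank W
  obtain ⟨ρZ, -, hZ, -⟩ := exists_rank (V × W)
  -- the vertices of `G` come first, then those of `H`, and then the pairs
  let ρ : (V × W) ⊕ (V ⊕ W) → ℕ :=
    Sum.elim (fun p => N + M + ρZ p) (Sum.elim ρV fun b => N + ρW b)
  have hρ : Function.Injective ρ := by
    rintro (p | a | b) (p' | a' | b') h <;> simp only [ρ, Sum.elim_inl, Sum.elim_inr] at h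
    · rw [hZ (Nat.add_left_cancel h)]
    · have := hVN a'
      omega
    · have := hWM b'
      omega
    · have := hVN a
      omega
    · rw [hV h]
    · have := hVN a
      omega
    · have := hWM b
      omega
    · have := hVN a'
      omega
    · rw [hW (Nat.add_left_cancel h)]
  have hlt : ∀ a b, (ρ ∘ (.inr : V ⊕ W ↪ (V × W) ⊕ (V ⊕ W))) (.inl a) <
      (ρ ∘ (.inr : V ⊕ W ↪ (V × W) ⊕ (V ⊕ W))) (.inr b) := fun a b =>
    lt_of_lt_of_le (hVN a) (Nat.le_add_right _ _)
  have hinr : Function.Injective (ρ ∘ (.inr : V ⊕ W ↪ (V × W) ⊕ (V ⊕ W))) :=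
    hρ.comp Sum.inr_injective
  rw [bettiNumber_eq_cohDim_map hρ .inl, cohDim_strongProd_eq_join hρ, cohDim_map,
    cohDim_joinFamily hinr hlt ordConnected_cliqueFamily ordConnected_cliqueFamily,
    Finset.Nat.antidiagonal_succ_succ']
  simp only [Finset.sum_cons, Finset.sum_map, cohDim_cliqueFamily_zero, mul_zero, zero_mul,
    zero_add]
  refine Finset.sum_congr rfl fun ij _ => ?_
  rw [bettiNumber_eq_cohDim (hinr.comp Sum.inl_injective) ij.1,
    bettiNumber_eq_cohDim (hinr.comp Sum.inr_injective) ij.2]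
  rfl

end StrongProduct

/-! ### The Poincaré polynomial on the strong ring -/

section Ring

variable {V : Type u} {W : Type v} [Finite V] [Finite W] (G : SimpleGraph V) (H : SimpleGraph W)

theorem poincarePolynomial_sum :
    poincarePolynomial (G.sum H) = poincarePolynomial G + poincarePolynomial H := by
  ext k
  rw [Polynomial.coeff_add]
  simp only [coeff_poincarePolynomial, bettiNumber_sum]
  push_cast
  rfl

theorem poincarePolynomial_strongProd :
    poincarePolynomial (strongProd G H) = poincarePolynomial G * poincarePolynomial H := by
  ext k
  rw [Polynomial.coeff_mul]
  simp only [coeff_poincarePolynomial, bettiNumber_strongProd]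
  push_cast
  rfl

/-- The Poincaré polynomial as a homomorphism on the semiring of isomorphism classes of graphs. -/
def GraphClass.poincareHom : GraphClass.{w} →+* ℤ[X] where
  toFun := Quotient.lift (fun G : FinGraph.{w} => poincarePolynomial G.graph)
    fun _ _ ⟨e⟩ => poincarePolynomial_congr e
  map_zero' := by
    change poincarePolynomial (⊥ : SimpleGraph PEmpty) = 0
    simp [poincarePolynomial]
  map_one' := by
    change poincarePolynomial (⊥ : SimpleGraph PUnit) = 1
    simp [poincarePolynomial, bettiNumber_zero_of_unique]
  map_add' a b := by
    induction a using GraphClass.ind with | h G => ?_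
    induction b using GraphClass.ind with | h H => ?_
    exact poincarePolynomial_sum G.graph H.graph
  map_mul' a b := by
    induction a using GraphClass.ind with | h G => ?_
    induction b using GraphClass.ind with | h H => ?_
    exact poincarePolynomial_strongProd G.graph H.graph

end Ring

section Lift

variable {R : Type u} [CommSemiring R] {A : Type v} [CommRing A]

/-- The extension of a semiring homomorphism to the Grothendieck ring. -/
def GrothendieckRing.lift (f : R →+* A) : GrothendieckRing R →+* A where
  __ := liftAdd (f : R →+ A)
  map_one' := (liftAdd_ofAdd (f : R →+ A) 1).trans f.map_one
  map_mul' x y := by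
    have h : ∀ a, liftAdd (f : R →+ A) (ofAdd a) = f a := liftAdd_ofAdd _
    obtain ⟨a, b, rfl⟩ := exists_eq_sub x
    obtain ⟨c, d, rfl⟩ := exists_eq_sub y
    change liftAdd (f : R →+ A) _ = liftAdd (f : R →+ A) _ * liftAdd (f : R →+ A) _
    simp only [mul_def, map_sub, AddMonoidHom.sub_apply, mulHom_ofAdd, h, map_mul]
    ring

theorem GrothendieckRing.lift_of (f : R →+* A) (a : R) : lift f (of a) = f a :=
  liftAdd_ofAdd (f : R →+ A) a

end Lift

theorem lift_poincareHom_ofGraph (G : FinGraph.{w}) :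
    GrothendieckRing.lift GraphClass.poincareHom (SignedGraph.ofGraph G) =
      poincarePolynomial G.graph :=
  GrothendieckRing.lift_of GraphClass.poincareHom (GraphClass.mk G)

end StrongRing

end

theorem mainTheorem3 :
    (∀ (V : Type u) (W : Type v) [Finite V] [Finite W] (G : SimpleGraph V) (H : SimpleGraph W),
      StrongRing.poincarePolynomial (G.sum H) =
          StrongRing.poincarePolynomial G + StrongRing.poincarePolynomial H ∧
        StrongRing.poincarePolynomial (StrongRing.strongProd G H) =
          StrongRing.poincarePolynomial G * StrongRing.poincarePolynomial H ∧
        ∀ k : ℕ, StrongRing.bettiNumber (StrongRing.strongProd G H) k =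
          ∑ ij ∈ Finset.HasAntidiagonal.antidiagonal k,
            StrongRing.bettiNumber G ij.1 * StrongRing.bettiNumber H ij.2) ∧
    ∃! φ : StrongRing.SignedGraph.{w} →+* ℤ[X],
      ∀ G : StrongRing.FinGraph.{w},
        φ (StrongRing.SignedGraph.ofGraph G) = StrongRing.poincarePolynomial G.graph := by
  refine ⟨fun V W _ _ G H => ⟨StrongRing.poincarePolynomial_sum G H,
    StrongRing.poincarePolynomial_strongProd G H, StrongRing.bettiNumber_strongProd⟩,
    StrongRing.GrothendieckRing.lift StrongRing.GraphClass.poincareHom,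
    StrongRing.lift_poincareHom_ofGraph, fun φ hφ => ?_⟩
  refine RingHom.ext fun x => ?_
  obtain ⟨a, b, rfl⟩ := StrongRing.GrothendieckRing.exists_eq_sub x
  induction a using StrongRing.GraphClass.ind with | h G => ?_
  induction b using StrongRing.GraphClass.ind with | h H => ?_
  rw [map_sub, map_sub]
  exact congrArg₂ _ ((hφ G).trans (StrongRing.lift_poincareHom_ofGraph G).symm)
    ((hφ H).trans (StrongRing.lift_poincareHom_ofGraph H).symm)
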